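/- Let $\mathcal P$ be the set of real quintuples $\boldsymbol p=(\lambda,\mu,a,b,c)$ with $0<\lambda<1$, $\mu>0$, $0\le c<b\le 1$, [$\lambda\mu\le 1$ or $(1-b)\mu\le 1-c$], $b-b\lambda<a<b-c\lambda$ and $(1-\lambda)(c-\mu b)<(1-\mu)a$. Put $I=[0,1)$ and $\eta=(b-a)/\lambda$. For $\boldsymbol p\in\mathcal P$ let $f=f_{\boldsymbol p}\colon I\to I$ be given by $f(x)=\lambda x+a$ for $0\le x<\eta$ and $f(x)=\lambda\mu(x-\eta)+c$ for $\eta\le x<1$. Let $F\colon\mathbb R\to\mathbb R$ be its lift, $F(x)=\lambda x+a+(1-\lambda)\lfloor x\rfloor$ if $\{x\}<\eta$ and $F(x)=\lambda\mu(x-\eta)+c+1+(1-\lambda\mu)\lfloor x\rfloor$ if $\{x\}\ge\eta$. Here $\lfloor x\rfloor$ and $\{x\}$ are the integer and fractional parts. The rotation number $\rho=\rho(f)\in[0,1)$ is the common value modulo $1$ of the limits $\lim_{n\to\infty}F^n(x)/n$, $x\in\mathbb R$. Let $$C=\bigcap_{n\ge 0}f^n(I),\qquad \omega(x)=\bigcap_{n\ge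 0}\overline{\{f^k(x):k\ge n\}}\quad(x\in I),$$ with closures taken in $\mathbb R$. Let $r_{\lambda,\mu}=1$ if $\lambda\mu<1$ and $r_{\lambda,\mu}=-\log\lambda/\log\mu$ if $\lambda\mu\ge 1$. For $0<r<r_{\lambda,\mu}$ put $$\sigma(r)=\sum_{k\ge 1}\bigl(\lfloor (k+1)r\rfloor-\lfloor kr\rfloor\bigr)\lambda^k\mu^{\lfloor kr\rfloor},\qquad \mathbf a(r)=\frac{(1-\lambda)(b+(\mu b-c)\sigma(r))}{1+(\mu-1)\sigma(r)},$$ and for coprime positive integers $p,q$ with $p/q<r_{\lambda,\mu}$ let $\mathbf a((p/q)^-)$ be given by the same formula as $\mathbf a(p/q)$ with $\sigma(p/q)$ replaced by $$\sigma((p/q)^-)=\sigma(p/q)-\frac{\lambda^{q-1}\mu^{p-1}(1-\lambda)}{1-\lambda^q\mu^p}.$$ Finally, for $0<r<1$ with $\lambda\mu^r<1$ define $\phi_r\colon\mathbb R\to\mathbb R$ by $$\phi_r(y)=\lfloor y\rfloor+\frac{a}{1-\lambda}+\frac{(1-\lambda)(c-\mu b)+a(\mu-1)}{\lambda}\,\Phi_r(\lambda,\mu,-\{y\}),\qquad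 \Phi_r(\lambda,\mu,y)=\sum_{k\ge 0}\ \sum_{0\le l<kr+y}\lambda^k\mu^l,$$ empty sums being zero. **Theorem.** Let $\boldsymbol p=(\lambda,\mu,a,b,c)\in\mathcal P$. These objects are well defined: $f(I)\subseteq I$; the rotation number $\rho$ exists and satisfies $0<\rho<r_{\lambda,\mu}\le 1$ and $\lambda\mu^{\rho}<1$; and $\mathbf a(r)\to\mathbf a((p/q)^-)$ as $r\to p/q$ from the left, for all coprime positive integers $p,q$ with $p/q<r_{\lambda,\mu}$. Put $\phi=\phi_\rho$, and let $R_\rho(x)=\{x+\rho\}$ be the rotation of $I$ by $\rho$. 1. If $\rho$ is irrational, then $C=\phi(I)$, the closure $\overline C$ is a Cantor set (nonempty, compact, perfect and totally disconnected), and $\omega(x)=\overline C$ for every $x\in I$. Moreover $\phi\colon I\to C$ is a bijection, $f(C)\subseteq C$, and $f\circ\phi=\phi\circ R_\rho$ on $I$. 2. If $\rho=p/q$ with $p,q$ coprime positive integers and $\mathbf a((p/q)^-)\le a<\mathbf a(p/q)$, then for every $x\in I$ $$C=\omega(x)=\phi(I)=\{\phi(m/q):0\le m<q\}.$$ This set is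 a periodic orbit of $f$ of exact period $q$; $\phi$ is a bijection from $\{m/q:0\le m<q\}$ onto $C$; the maps $R_{p/q}$ and $f$ send $\{m/q:0\le m<q\}$ and $C$, respectively, into themselves; and $f\circ\phi=\phi\circ R_{p/q}$ on $\{m/q:0\le m<q\}$. 3. If $a=\mathbf a(p/q)$ for some coprime positive integers $p,q$ with $p/q<r_{\lambda,\mu}$, then $C$ is empty, $\phi(I)$ is a finite set containing $b$, and $\omega(x)=\phi(I)$ for every $x\in I$. -/

import Mathlib

open Set Filter Topology

namespace TwoInterval

/-- A quintuple of real parameters `(lam, mu, a, b, c)`. -/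
structure Params where
  lam : ℝ
  mu : ℝ
  a : ℝ
  b : ℝ
  c : ℝ

/-- The set of admissible quintuples. -/
def paramSet : Set Params :=
  {P | (0 < P.lam ∧ P.lam < 1) ∧ 0 < P.mu ∧ (0 ≤ P.c ∧ P.c < P.b ∧ P.b ≤ 1) ∧
    (P.lam * P.mu ≤ 1 ∨ (1 - P.b) * P.mu ≤ 1 - P.c) ∧
    (P.b - P.b * P.lam < P.a ∧ P.a < P.b - P.c * P.lam) ∧
    (1 - P.lam) * (P.c - P.mu * P.b) < (1 - P.mu) * P.a}

/-- The unit interval `I = [0, 1)`. -/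
def I : Set ℝ := Ico 0 1

/-- The break point. -/
noncomputable def Params.eta (P : Params) : ℝ := (P.b - P.a) / P.lam

/-- The two-interval piecewise affine map; only its values on `I` matter. -/
noncomputable def Params.f (P : Params) (x : ℝ) : ℝ :=
  if x < P.eta then P.lam * x + P.a else P.lam * P.mu * (x - P.eta) + P.c

/-- The lift of `f` to the real line. -/
noncomputable def Params.F (P : Params) (x : ℝ) : ℝ :=
  if Int.fract x < P.eta then P.lam * x + P.a + (1 - P.lam) * ⌊x⌋
  else P.lam * P.mu * (x - P.eta) + P.c + 1 + (1 - P.lam * P.mu) * ⌊x⌋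

/-- `rho` is the rotation number of `f`: the limits of `F^n(x) / n` exist for all real `x`,
do not depend on `x`, and are equal to `rho` modulo one, where `0 ≤ rho < 1`. -/
def Params.IsRotationNumber (P : Params) (rho : ℝ) : Prop :=
  ∃ L : ℝ, (∀ x : ℝ, Tendsto (fun n : ℕ => P.F^[n] x / n) atTop (𝓝 L)) ∧ rho = Int.fract L

/-- The upper end of the range of rotation numbers for given slopes. -/
noncomputable def rMax (lam mu : ℝ) : ℝ :=
  if lam * mu < 1 then 1 else -(Real.log lam / Real.log mu)

/-- `σ(lam, mu, rho) = ∑_{k ≥ 1} (⌊(k+1) rho⌋ - ⌊k rho⌋) lam ^ k * mu ^ ⌊k rho⌋`, for `rho > 0`;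
the series is indexed by `j = k - 1`. -/
noncomputable def sigma (lam mu rho : ℝ) : ℝ :=
  ∑' j : ℕ, ((⌊((j : ℝ) + 2) * rho⌋₊ : ℝ) - (⌊((j : ℝ) + 1) * rho⌋₊ : ℝ)) *
    lam ^ (j + 1) * mu ^ ⌊((j : ℝ) + 1) * rho⌋₊

/-- The value `σ(lam, mu, (p/q)^-)`. -/
noncomputable def sigmaLeft (lam mu : ℝ) (p q : ℕ) : ℝ :=
  sigma lam mu ((p : ℝ) / q) -
    lam ^ (q - 1) * mu ^ (p - 1) * (1 - lam) / (1 - lam ^ q * mu ^ p)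

/-- The common shape of `𝐚(lam, mu, b, c, rho)` and of its left limits, as a function of `σ`. -/
noncomputable def aOfSigma (lam mu b c s : ℝ) : ℝ :=
  (1 - lam) * (b + (mu * b - c) * s) / (1 + (mu - 1) * s)

/-- The function `𝐚(lam, mu, b, c, rho)`. -/
noncomputable def aFun (lam mu b c rho : ℝ) : ℝ :=
  aOfSigma lam mu b c (sigma lam mu rho)

/-- The value `𝐚(lam, mu, b, c, (p/q)^-)`. -/
noncomputable def aLeft (lam mu b c : ℝ) (p q : ℕ) : ℝ :=
  aOfSigma lam mu b c (sigmaLeft lam mu p q)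

/-- `Φ_rho(lam, mu, y) = ∑_{k ≥ 0} ∑_{0 ≤ l < k rho + y} lam ^ k * mu ^ l`; the natural numbers
`l < ⌈t⌉₊` are exactly those with `l < t`. -/
noncomputable def Phi (rho lam mu y : ℝ) : ℝ :=
  ∑' k : ℕ, ∑ l ∈ Finset.range ⌈(k : ℝ) * rho + y⌉₊, lam ^ k * mu ^ l

/-- The function `φ` attached to the parameters and to `rho`. -/
noncomputable def Params.phi (P : Params) (rho y : ℝ) : ℝ :=
  (⌊y⌋ : ℝ) + P.a / (1 - P.lam) +
    ((1 - P.lam) * (P.c - P.mu * P.b) + P.a * (P.mu - 1)) / P.lam *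
      Phi rho P.lam P.mu (-Int.fract y)

/-- The rotation of angle `rho` on `I = [0, 1)`. -/
noncomputable def rot (rho x : ℝ) : ℝ := Int.fract (x + rho)

/-- The limit set `C = ⋂ₙ fⁿ(I)`. -/
def limitSet (f : ℝ → ℝ) : Set ℝ := ⋂ n : ℕ, f^[n] '' I

/-- The ω-limit set of `x`; closures are taken in `ℝ`. -/
def omegaSet (f : ℝ → ℝ) (x : ℝ) : Set ℝ := ⋂ n : ℕ, closure {y | ∃ k : ℕ, n ≤ k ∧ y = f^[k] x}

/-- A Cantor set in the real line: nonempty, compact, perfect, totally disconnected. -/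
def IsCantorSet (S : Set ℝ) : Prop :=
  S.Nonempty ∧ IsCompact S ∧ Perfect S ∧ IsTotallyDisconnected S

/-- `S` is a periodic orbit of `f` of exact period `q`. -/
def IsCycle (f : ℝ → ℝ) (q : ℕ) (S : Set ℝ) : Prop :=
  0 < q ∧ ∃ x ∈ S, Function.minimalPeriod f x = q ∧ S = {y | ∃ n : ℕ, y = f^[n] x}

/-- The finite subset `{m/q : 0 ≤ m < q}` of the circle. -/
def gridPts (q : ℕ) : Set ℝ := {y | ∃ m : ℕ, m < q ∧ y = (m : ℝ) / q}

end TwoInterval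

/-!
The dynamics takes place on `J = [c, b)`: every orbit of `I` enters `J` after a bounded time
(`Params.Facts.exists_entry`), and on `J` the map is injective, with an image that misses one gap.
Glued along its endpoints `J` is a circle, on which `f` has a monotone lift of degree one,
discontinuous at the integers. Its translation number is the rotation number `rho`; the number
`S n` of visits of an orbit to the right branch during `n` steps satisfies `|S n - n * rho| ≤ 1`.
The distance from the orbit to the fixed point `a / (1 - lam)` of the left branch stays bounded,
although a visit to the right branch multiplies it by a little more than `lam * mu`; this forces
`lam * mu ^ rho < 1` (`Params.Facts.admissible`), so that the series `Phi` converges.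

For every angle `r` at which the series converges, `phi_r` satisfies two exact relations on
`[0, 1)`: `phi (y + r)` is the left affine branch applied to `phi y` if `y < 1 - r`, and
`phi (y + r - 1)` is the right affine branch applied to `phi y` if `1 - r ≤ y`
(`Params.Facts.phi_left`, `Params.Facts.phi_right`). Hence, if the orbit of `x` takes the branches
in the order prescribed by the rotation of `y`, then `f^n x - phi (y + n r)` is `x - phi y` times
the product `lam ^ n * mu ^ S n` of slopes, which tends to zero (`Params.Facts.follows_sub`).

Every orbit of `J` eventually does follow an orbit of the rotation, and so does every backward
orbit. This is a statement on integer sequences (`exists_floor_line`): a sequence `S` for which the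
numbers `S n - n θ` stay within distance one of each other is eventually of the form `⌊y + n θ⌋`.
For irrational `θ` one takes for `y` the supremum of `S n - n θ`; for `θ` with denominator `q` the
monotonicity of the lift makes `S n - n θ` eventually `q`-periodic first, and then `y` is a multiple
of `1 / q`. So each orbit is asymptotic to the image under `phi` of an orbit of the rotation
(`Params.Facts.exists_asymptotic`), which gives the `ω`-limit sets, and each backward orbit in `J`
eventually equals such an image (`Params.Facts.exists_backward`), which gives the limit set.

The orbit of `c` itself is asymptotic to some `phi (y + n rho)` and visits the two branches in the
order of the rotation, so `phi` is at most the break point `eta` on `[0, 1 - rho)` and at least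
`eta` on `[1 - rho, 1)`. If `rho` is irrational the first inequality is strict because `phi` is
strictly increasing, and `phi` conjugates the rotation to `f`. If `rho = p / q`, then `phi` is a
step function on the grid of multiples of `1 / q`, and the inequality is strict unless `phi` takes
the value `b` at the last grid point. Summation by parts shows that the latter means exactly
`a = 𝐚(p / q)` (`Params.Facts.phi_last_eq_iff`). In that case a backward orbit would have to pass
through `b`, so the limit set is empty; and the orbits of points slightly to the left of `b` show
that the rotation number is indeed `p / q` (`Params.Facts.rotNum_endpoint`).
-/

namespace TwoInterval

/-! ### Blocks of the double series `Phi` -/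

/-- Slopes and rotation angle for which the series defining `Phi` and `sigma` converge. -/
structure Admissible (lam mu r : ℝ) : Prop where
  lam_pos : 0 < lam
  lam_lt : lam < 1
  mu_pos : 0 < mu
  r_pos : 0 < r
  r_lt : r < 1
  conv : lam * mu ^ r < 1

/-- The `k`-th block `lam ^ k * (1 + mu + ⋯ + mu ^ (n - 1))` of the double series `Phi`. -/
noncomputable def geo (lam mu : ℝ) (k n : ℕ) : ℝ := ∑ l ∈ Finset.range n, lam ^ k * mu ^ l

section Geo

variable {lam mu : ℝ}

lemma geo_zero (k : ℕ) : geo lam mu k 0 = 0 := by simp [geo]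

lemma geo_pow_succ (k n : ℕ) : geo lam mu (k + 1) n = lam * geo lam mu k n := by
  simp only [geo, Finset.mul_sum, pow_succ]
  exact Finset.sum_congr rfl fun _ _ => by ring

lemma geo_succ (k n : ℕ) : geo lam mu k (n + 1) = geo lam mu k n + lam ^ k * mu ^ n := by
  simp [geo, Finset.sum_range_succ]

lemma geo_succ' (k n : ℕ) : geo lam mu k (n + 1) = lam ^ k + mu * geo lam mu k n := by
  simp only [geo, Finset.sum_range_succ', Finset.mul_sum, pow_zero, mul_one]
  rw [add_comm]
  congr 1
  exact Finset.sum_congr rfl fun _ _ => by ring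

lemma geo_nonneg (hl : 0 < lam) (hm : 0 < mu) (k n : ℕ) : 0 ≤ geo lam mu k n :=
  Finset.sum_nonneg fun _ _ => by positivity

lemma geo_mono (hl : 0 < lam) (hm : 0 < mu) (k : ℕ) {m n : ℕ} (h : m ≤ n) :
    geo lam mu k m ≤ geo lam mu k n :=
  Finset.sum_le_sum_of_subset_of_nonneg (Finset.range_mono h) fun _ _ _ => by positivity

lemma sub_one_mul_geo (k n : ℕ) : (mu - 1) * geo lam mu k n = lam ^ k * mu ^ n - lam ^ k := by
  induction n with
  | zero => simp [geo]
  | succ n ih => rw [geo_succ, mul_add, ih]; ring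

end Geo

section Series

variable {lam mu r : ℝ}

/-- A summable majorant for all the series of the shape `∑ geo k (N k)` with `N k ≤ k r + 2`. -/
lemma Admissible.exists_bound (h : Admissible lam mu r) :
    ∃ g : ℕ → ℝ, Summable g ∧ ∀ k n : ℕ, (n : ℝ) ≤ k * r + 2 → geo lam mu k n ≤ g k := by
  obtain ⟨hl0, hl1, hm, hr0, hr1, hc⟩ := h
  set M := max 1 mu with hM
  have hM1 : 1 ≤ M := le_max_left _ _
  have hM0 : 0 < M := by linarith
  have hθ : lam * M ^ r < 1 := by
    rcases max_cases 1 mu with ⟨h1, -⟩ | ⟨h1, -⟩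
    · rw [hM, h1]; simpa using hl1
    · rw [hM, h1]; exact hc
  have hθ0 : 0 < lam * M ^ r := by positivity
  refine ⟨fun k => ((k : ℝ) ^ 1 * (lam * M ^ r) ^ k) * (r * M ^ (2 : ℝ))
    + (lam * M ^ r) ^ k * (2 * M ^ (2 : ℝ)), ?_, ?_⟩
  · refine Summable.add (Summable.mul_right _ ?_) (Summable.mul_right _ ?_)
    · exact summable_pow_mul_geometric_of_norm_lt_one 1
        (by rwa [Real.norm_eq_abs, abs_of_pos hθ0])
    · exact summable_geometric_of_lt_one hθ0.le hθ
  · intro k n hn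
    have h1 : geo lam mu k n ≤ n * (lam ^ k * M ^ ((k : ℝ) * r + 2)) := by
      calc geo lam mu k n ≤ ∑ l ∈ Finset.range n, lam ^ k * M ^ ((k : ℝ) * r + 2) := by
            refine Finset.sum_le_sum fun l hl => ?_
            refine mul_le_mul_of_nonneg_left ?_ (by positivity)
            calc mu ^ l ≤ M ^ l := pow_le_pow_left₀ hm.le (le_max_right _ _) _
              _ = M ^ (l : ℝ) := (Real.rpow_natCast _ _).symm
              _ ≤ _ := Real.rpow_le_rpow_of_exponent_le hM1 (by
                have : (l : ℝ) ≤ n := by exact_mod_cast (Finset.mem_range.1 hl).le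
                linarith)
        _ = _ := by simp
    have h2 : M ^ ((k : ℝ) * r + 2) = (M ^ r) ^ k * M ^ (2 : ℝ) := by
      rw [Real.rpow_add hM0, mul_comm (k : ℝ) r, Real.rpow_mul hM0.le, Real.rpow_natCast]
    calc geo lam mu k n ≤ n * (lam ^ k * M ^ ((k : ℝ) * r + 2)) := h1
      _ ≤ (k * r + 2) * (lam ^ k * M ^ ((k : ℝ) * r + 2)) :=
        mul_le_mul_of_nonneg_right hn (by positivity)
      _ = _ := by rw [h2]; simp only [mul_pow]; ring

lemma Admissible.summable_geo (h : Admissible lam mu r) {N : ℕ → ℕ}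
    (hN : ∀ k, (N k : ℝ) ≤ k * r + 2) : Summable fun k => geo lam mu k (N k) := by
  obtain ⟨g, hg, hb⟩ := h.exists_bound
  exact Summable.of_nonneg_of_le (fun k => geo_nonneg h.lam_pos h.mu_pos _ _)
    (fun k => hb k _ (hN k)) hg

/-- Dominated convergence: if each `N x k` is eventually equal to `N₀ k`, the series converge. -/
lemma Admissible.tendsto_geo_tsum {α : Type*} {F : Filter α} (h : Admissible lam mu r)
    {N : α → ℕ → ℕ} {N₀ : ℕ → ℕ} (hN : ∀ᶠ x in F, ∀ k, (N x k : ℝ) ≤ k * r + 2)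
    (hlim : ∀ k, ∀ᶠ x in F, N x k = N₀ k) :
    Tendsto (fun x => ∑' k, geo lam mu k (N x k)) F (𝓝 (∑' k, geo lam mu k (N₀ k))) := by
  obtain ⟨g, hg, hb⟩ := h.exists_bound
  refine tendsto_tsum_of_dominated_convergence hg (fun k => ?_) ?_
  · refine tendsto_const_nhds.congr' ?_
    filter_upwards [hlim k] with x hx
    rw [hx]
  · filter_upwards [hN] with x hx k
    rw [Real.norm_eq_abs, abs_of_nonneg (geo_nonneg h.lam_pos h.mu_pos _ _)]
    exact hb k _ (hx k)

/-- Products of the slopes along an orbit that rotates at speed `r` tend to zero. -/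
lemma Admissible.tendsto_slope (h : Admissible lam mu r) {S : ℕ → ℕ}
    (hS : ∀ n, (S n : ℝ) ≤ n * r + 1) :
    Tendsto (fun n => lam ^ n * mu ^ S n) atTop (𝓝 0) := by
  have h1 := (h.summable_geo (N := fun n => S n + 1)
    (fun k => by push_cast; linarith [hS k])).tendsto_atTop_zero
  refine squeeze_zero (fun n => ?_) (fun n => ?_) h1
  · have := h.lam_pos; have := h.mu_pos; positivity
  · rw [geo_succ]
    linarith [geo_nonneg h.lam_pos h.mu_pos n (S n)]

lemma ceil_le_bound (hr : 0 < r) {y : ℝ} (hy : 0 ≤ y) (k : ℕ) :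
    ((⌈(k : ℝ) * r + -y⌉₊ : ℕ) : ℝ) ≤ k * r + 1 := by
  rcases le_or_gt 0 ((k : ℝ) * r + -y) with h0 | h0
  · linarith [Nat.ceil_lt_add_one h0]
  · rw [Nat.ceil_eq_zero.2 h0.le]
    have : 0 ≤ (k : ℝ) * r := by positivity
    push_cast; linarith

lemma Admissible.summable_Phi (h : Admissible lam mu r) {y : ℝ} (hy : 0 ≤ y) :
    Summable fun k : ℕ => geo lam mu k ⌈(k : ℝ) * r + -y⌉₊ :=
  h.summable_geo fun k => by linarith [ceil_le_bound h.r_pos hy k]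

/-- A rotation that does not pass `1` shifts the outer index of the double series. -/
lemma Admissible.Phi_rot_left (h : Admissible lam mu r) {y : ℝ} (hy : 0 ≤ y) :
    Phi r lam mu (-(y + r)) = lam * Phi r lam mu (-y) := by
  have hr := h.r_pos
  change ∑' k : ℕ, geo lam mu k ⌈(k : ℝ) * r + -(y + r)⌉₊
    = lam * ∑' k : ℕ, geo lam mu k ⌈(k : ℝ) * r + -y⌉₊
  rw [(h.summable_Phi (by linarith : 0 ≤ y + r)).tsum_eq_zero_add, ← tsum_mul_left]
  have h0 : ⌈((0 : ℕ) : ℝ) * r + -(y + r)⌉₊ = 0 := Nat.ceil_eq_zero.2 (by push_cast; linarith)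
  rw [h0, geo_zero, zero_add]
  refine tsum_congr fun k => ?_
  rw [geo_pow_succ]
  congr 3
  push_cast; ring

/-- A rotation that passes `1` shifts both indices of the double series, which adds the terms with
`l = 0`. -/
lemma Admissible.Phi_rot_right (h : Admissible lam mu r) {y : ℝ} (hy : 1 - r ≤ y) (hy1 : y < 1) :
    Phi r lam mu (-(y + r - 1)) = lam * (1 / (1 - lam) + mu * Phi r lam mu (-y)) := by
  have hr := h.r_pos
  have hr1 := h.r_lt
  change ∑' k : ℕ, geo lam mu k ⌈(k : ℝ) * r + -(y + r - 1)⌉₊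
    = lam * (1 / (1 - lam) + mu * ∑' k : ℕ, geo lam mu k ⌈(k : ℝ) * r + -y⌉₊)
  have hs := h.summable_Phi (by linarith : 0 ≤ y)
  rw [(h.summable_Phi (by linarith : 0 ≤ y + r - 1)).tsum_eq_zero_add]
  have h0 : ⌈((0 : ℕ) : ℝ) * r + -(y + r - 1)⌉₊ = 0 :=
    Nat.ceil_eq_zero.2 (by push_cast; linarith)
  rw [h0, geo_zero, zero_add, one_div, ← tsum_geometric_of_lt_one h.lam_pos.le h.lam_lt,
    ← tsum_mul_left, ← Summable.tsum_add (summable_geometric_of_lt_one h.lam_pos.le h.lam_lt)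
      (hs.mul_left _), ← tsum_mul_left]
  refine tsum_congr fun k => ?_
  have hk : ⌈((k + 1 : ℕ) : ℝ) * r + -(y + r - 1)⌉₊ = ⌈(k : ℝ) * r + -y⌉₊ + 1 := by
    have e : ((k + 1 : ℕ) : ℝ) * r + -(y + r - 1) = ((k : ℝ) * r + -y) + 1 := by push_cast; ring
    have hkr : 0 ≤ (k : ℝ) * r := by positivity
    rw [e]
    rcases le_or_gt 0 ((k : ℝ) * r + -y) with h1 | h1
    · exact Nat.ceil_add_one h1
    · rw [Nat.ceil_eq_zero.2 h1.le, Nat.ceil_eq_iff (by norm_num)]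
      constructor <;> norm_num <;> linarith
  rw [hk, geo_pow_succ, geo_succ']

lemma Admissible.Phi_antitone (h : Admissible lam mu r) {y y' : ℝ} (hy : 0 ≤ y) (hyy : y ≤ y') :
    Phi r lam mu (-y') ≤ Phi r lam mu (-y) := by
  refine Summable.tsum_le_tsum (fun k => ?_) (h.summable_Phi (hy.trans hyy)) (h.summable_Phi hy)
  exact geo_mono h.lam_pos h.mu_pos k (Nat.ceil_mono (by linarith))

/-- `y ↦ Phi (-y)` drops by at least `lam ^ k * mu ^ l` across the point `k r - l`. -/
lemma Admissible.Phi_jump (h : Admissible lam mu r) {y y' : ℝ} (hy : 0 ≤ y) {k l : ℕ}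
    (h1 : y < k * r - l) (h2 : k * r - l ≤ y') :
    Phi r lam mu (-y') + lam ^ k * mu ^ l ≤ Phi r lam mu (-y) := by
  have hyy : y ≤ y' := by linarith
  have hs := h.summable_Phi hy
  have hs' := h.summable_Phi (hy.trans hyy)
  have key : lam ^ k * mu ^ l ≤ ∑' j : ℕ, (geo lam mu j ⌈(j : ℝ) * r + -y⌉₊
      - geo lam mu j ⌈(j : ℝ) * r + -y'⌉₊) := by
    refine le_trans ?_ ((hs.sub hs').le_tsum k fun j _ => ?_)
    · have a1 : ⌈(k : ℝ) * r + -y'⌉₊ ≤ l := Nat.ceil_le.2 (by linarith)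
      have a2 : l + 1 ≤ ⌈(k : ℝ) * r + -y⌉₊ := Nat.lt_ceil.2 (by linarith)
      have b1 := geo_mono h.lam_pos h.mu_pos k a1
      have b2 := geo_mono h.lam_pos h.mu_pos k a2
      rw [geo_succ] at b2
      linarith
    · exact sub_nonneg.2 (geo_mono h.lam_pos h.mu_pos j (Nat.ceil_mono (by linarith)))
  rw [hs.tsum_sub hs'] at key
  change (∑' k : ℕ, geo lam mu k ⌈(k : ℝ) * r + -y'⌉₊) + lam ^ k * mu ^ l
    ≤ ∑' k : ℕ, geo lam mu k ⌈(k : ℝ) * r + -y⌉₊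
  linarith

/-- The condition `l < k r - y` survives a small increase of `y`, so `Phi` is right continuous. -/
lemma Admissible.Phi_right_continuous (h : Admissible lam mu r) {y₀ : ℝ} (hy : 0 ≤ y₀) :
    Tendsto (fun y => Phi r lam mu (-y)) (𝓝[>] y₀) (𝓝 (Phi r lam mu (-y₀))) := by
  refine h.tendsto_geo_tsum (N := fun y k => ⌈(k : ℝ) * r + -y⌉₊) ?_ fun k => ?_
  · filter_upwards [self_mem_nhdsWithin] with y hy' k
    linarith [ceil_le_bound h.r_pos (hy.trans (le_of_lt hy')) k]
  · rcases le_or_gt ((k : ℝ) * r + -y₀) 0 with h0 | h0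
    · filter_upwards [self_mem_nhdsWithin] with y hy'
      have : y₀ < y := hy'
      rw [Nat.ceil_eq_zero.2 h0, Nat.ceil_eq_zero.2 (by linarith)]
    · have hne : ⌈(k : ℝ) * r + -y₀⌉₊ ≠ 0 := (Nat.ceil_pos.2 h0).ne'
      obtain ⟨h1, h2⟩ := (Nat.ceil_eq_iff hne).1 rfl
      have hev : ∀ᶠ y in 𝓝[>] y₀, y < k * r - ((⌈(k : ℝ) * r + -y₀⌉₊ - 1 : ℕ) : ℝ) :=
        nhdsWithin_le_nhds (Iio_mem_nhds (by linarith))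
      filter_upwards [self_mem_nhdsWithin, hev] with y hy' hy2
      have : y₀ < y := hy'
      rw [Nat.ceil_eq_iff hne]
      constructor <;> linarith

end Series

/-! ### The functions `sigma` and `𝐚` -/

section Sigma

variable {lam mu r : ℝ}

/-- Summation by parts: a series over the increments of `N` is a series of blocks `geo`. -/
lemma Admissible.abel_summation (h : Admissible lam mu r) {N : ℕ → ℕ} (h1 : N 1 = 0)
    (hstep : ∀ k, N (k + 1) = N k ∨ N (k + 1) = N k + 1) (hN : ∀ k, (N k : ℝ) ≤ k * r + 2) :
    lam * ∑' j : ℕ, ((N (j + 2) : ℝ) - N (j + 1)) * lam ^ (j + 1) * mu ^ N (j + 1)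
      = (1 - lam) * ∑' k, geo lam mu k (N k) := by
  have h0 : N 0 = 0 := by rcases hstep 0 with h' | h' <;> simp_all
  have hs := h.summable_geo hN
  have hs1 := (summable_nat_add_iff 1).2 hs
  have hs2 := (summable_nat_add_iff 2).2 hs
  have e1 : ∑' k, geo lam mu (k + 1) (N (k + 1)) = ∑' k, geo lam mu k (N k) := by
    rw [hs.tsum_eq_zero_add, h0, geo_zero, zero_add]
  have e2 : ∑' k, geo lam mu (k + 2) (N (k + 2)) = ∑' k, geo lam mu k (N k) := by
    rw [← e1, hs1.tsum_eq_zero_add]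
    simp [h1, geo_zero]
  rw [sub_mul, one_mul]
  nth_rw 1 [← e2]
  rw [← e1, ← tsum_mul_left, ← tsum_mul_left, ← hs2.tsum_sub (hs1.mul_left lam)]
  refine tsum_congr fun j => ?_
  rcases hstep (j + 1) with h' | h'
  · rw [show j + 2 = j + 1 + 1 from rfl, h', geo_pow_succ (j + 1)]; simp
  · rw [show j + 2 = j + 1 + 1 from rfl, h', geo_succ, geo_pow_succ (j + 1)]; push_cast; ring

/-- The denominator in `aOfSigma` is positive: multiplied by `lam` it is
`lam - 1 + (1 - lam) * ∑ lam ^ k * mu ^ N k`, and the term `k = 0` of the series is `1`. -/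
lemma Admissible.denom_pos (h : Admissible lam mu r) {N : ℕ → ℕ} (h0 : N 0 = 0)
    (hN : ∀ k, (N k : ℝ) ≤ k * r + 1) {s : ℝ}
    (hs : lam * s = (1 - lam) * ∑' k, geo lam mu k (N k)) : 0 < 1 + (mu - 1) * s := by
  have hl := h.lam_pos
  have hl1 := h.lam_lt
  have hm := h.mu_pos
  have hg := h.summable_geo (N := N) fun k => by linarith [hN k]
  have hgeom := summable_geometric_of_lt_one hl.le hl1
  have e : (mu - 1) * ∑' k, geo lam mu k (N k) + (1 - lam)⁻¹ = ∑' k, lam ^ k * mu ^ N k := by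
    rw [← tsum_geometric_of_lt_one hl.le hl1, ← tsum_mul_left,
      ← (hg.mul_left _).tsum_add hgeom]
    exact tsum_congr fun k => by rw [sub_one_mul_geo]; ring
  have hsum : Summable fun k => lam ^ k * mu ^ N k := by
    refine ((hg.mul_left (mu - 1)).add hgeom).congr fun k => ?_
    rw [sub_one_mul_geo]; ring
  have h2 : 1 + lam * mu ^ N 1 ≤ ∑' k, lam ^ k * mu ^ N k := by
    refine le_trans ?_ (hsum.sum_le_tsum (Finset.range 2) fun _ _ => by positivity)
    simp [Finset.sum_range_succ, h0]
  have h3 : 0 < lam * mu ^ N 1 := by positivity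
  have h4 : (1 - lam) * (1 - lam)⁻¹ = 1 := mul_inv_cancel₀ (by linarith)
  have h5 : lam * (1 + (mu - 1) * s)
      = lam - 1 + (1 - lam) * ∑' k, lam ^ k * mu ^ N k := by
    rw [← e]
    linear_combination (mu - 1) * hs - h4
  have h6 : 0 < lam * (1 + (mu - 1) * s) := by
    rw [h5]; nlinarith
  exact pos_of_mul_pos_right h6 hl.le

lemma floor_step (hr : 0 < r) (hr1 : r < 1) (k : ℕ) :
    ⌊((k + 1 : ℕ) : ℝ) * r⌋₊ = ⌊(k : ℝ) * r⌋₊ ∨ ⌊((k + 1 : ℕ) : ℝ) * r⌋₊ = ⌊(k : ℝ) * r⌋₊ + 1 := by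
  have h1 : ⌊(k : ℝ) * r⌋₊ ≤ ⌊((k + 1 : ℕ) : ℝ) * r⌋₊ :=
    Nat.floor_le_floor (by push_cast; nlinarith)
  have h2 : ⌊((k + 1 : ℕ) : ℝ) * r⌋₊ ≤ ⌊(k : ℝ) * r⌋₊ + 1 := by
    rw [← Nat.floor_add_one (by positivity)]
    exact Nat.floor_le_floor (by push_cast; nlinarith)
  omega

lemma Admissible.sigma_eq (h : Admissible lam mu r) :
    lam * sigma lam mu r = (1 - lam) * ∑' k : ℕ, geo lam mu k ⌊(k : ℝ) * r⌋₊ := by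
  have hr := h.r_pos
  rw [← h.abel_summation (N := fun k => ⌊(k : ℝ) * r⌋₊)
    (Nat.floor_eq_zero.2 (by simpa using h.r_lt)) (floor_step h.r_pos h.r_lt)
    (fun k => by linarith [Nat.floor_le (show 0 ≤ (k : ℝ) * r by positivity)])]
  simp only [sigma]
  push_cast
  rfl

lemma Admissible.floor_le_bound (h : Admissible lam mu r) (k : ℕ) :
    ((⌊(k : ℝ) * r⌋₊ : ℕ) : ℝ) ≤ k * r + 1 := by
  have hr := h.r_pos
  linarith [Nat.floor_le (show 0 ≤ (k : ℝ) * r by positivity)]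

lemma Admissible.denom_sigma_pos (h : Admissible lam mu r) :
    0 < 1 + (mu - 1) * sigma lam mu r :=
  h.denom_pos (N := fun k => ⌊(k : ℝ) * r⌋₊) (by simp) h.floor_le_bound h.sigma_eq

variable {p q : ℕ}

/-- The value of the block series at `p / q` exceeds its left limit by a geometric series carried
by the multiples of `q`. -/
lemma Admissible.floor_sub_ceil_tsum (hq : 0 < q) (hp : 0 < p) (hpq : p.Coprime q)
    (h : Admissible lam mu ((p : ℝ) / q)) :
    ∑' k : ℕ, geo lam mu k ⌊(k : ℝ) * (p / q)⌋₊ - ∑' k : ℕ, geo lam mu k (⌈(k : ℝ) * (p / q)⌉₊ - 1)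
      = lam ^ q * mu ^ (p - 1) / (1 - lam ^ q * mu ^ p) := by
  have hq' : (0 : ℝ) < q := by exact_mod_cast hq
  have hp' : (0 : ℝ) < p := by exact_mod_cast hp
  have hl := h.lam_pos
  have hm := h.mu_pos
  have hs1 := h.summable_geo (N := fun k => ⌊(k : ℝ) * (p / q)⌋₊)
    fun k => by linarith [h.floor_le_bound k]
  have hs2 := h.summable_geo (N := fun k => ⌈(k : ℝ) * (p / q)⌉₊ - 1) fun k => by
    have a1 : ((⌈(k : ℝ) * (p / q)⌉₊ - 1 : ℕ) : ℝ) ≤ (⌈(k : ℝ) * (p / q)⌉₊ : ℝ) := by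
      exact_mod_cast Nat.sub_le _ _
    have a2 := Nat.ceil_lt_add_one (show 0 ≤ (k : ℝ) * ((p : ℝ) / q) by positivity)
    linarith
  rw [← hs1.tsum_sub hs2]
  have hx : lam ^ q * mu ^ p < 1 := by
    have h1 : lam ^ q * mu ^ p = (lam * mu ^ ((p : ℝ) / q)) ^ q := by
      rw [mul_pow, ← Real.rpow_mul_natCast hm.le, div_mul_cancel₀ _ hq'.ne', Real.rpow_natCast]
    rw [h1]
    exact pow_lt_one₀ (by positivity) h.conv hq.ne'
  set d : ℕ → ℝ := fun k => geo lam mu k ⌊(k : ℝ) * (p / q)⌋₊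
    - geo lam mu k (⌈(k : ℝ) * (p / q)⌉₊ - 1) with hd
  -- the two blocks differ only where `k * p / q` is a positive integer, that is, where `q ∣ k`
  have hinj : Function.Injective fun j : ℕ => q * (j + 1) := fun i j hij => by
    have := Nat.eq_of_mul_eq_mul_left hq hij
    omega
  have hsupp : Function.support d ⊆ Set.range fun j : ℕ => q * (j + 1) := by
    intro k hk
    by_contra hnot
    apply hk
    rcases Nat.eq_zero_or_pos k with rfl | hk0
    · simp [hd]
    have hndvd : ¬ q ∣ k := fun ⟨m, hm⟩ => hnot ⟨m - 1, by
      have : m ≠ 0 := by rintro rfl; omega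
      change q * (m - 1 + 1) = k
      rw [Nat.sub_add_cancel (by omega), hm]⟩
    have hint : ∀ n : ℕ, (k : ℝ) * (p / q) ≠ n := by
      intro n hn
      apply hndvd
      have : (k : ℝ) * p = n * q := by
        rw [← hn]; field_simp
      have h2 : k * p = n * q := by exact_mod_cast this
      exact (Nat.Coprime.dvd_of_dvd_mul_right hpq.symm ⟨n, by rw [h2, mul_comm]⟩)
    have hkpos : 0 < (k : ℝ) * (p / q) := by positivity
    have e : ⌈(k : ℝ) * (p / q)⌉₊ = ⌊(k : ℝ) * (p / q)⌋₊ + 1 := by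
      rw [Nat.ceil_eq_iff (by omega)]
      refine ⟨?_, ?_⟩
      · rw [Nat.add_sub_cancel]
        exact lt_of_le_of_ne (Nat.floor_le hkpos.le) (hint _).symm
      · push_cast; exact (Nat.lt_floor_add_one _).le
    simp only [hd, e, Nat.add_sub_cancel, sub_self]
  have hval : ∀ j : ℕ, d (q * (j + 1)) = lam ^ q * mu ^ (p - 1) * (lam ^ q * mu ^ p) ^ j := by
    intro j
    have e : ((q * (j + 1) : ℕ) : ℝ) * ((p : ℝ) / q) = ((p * (j + 1) : ℕ) : ℝ) := by
      push_cast; field_simp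
    have e2 : p * (j + 1) = (p * (j + 1) - 1) + 1 := by
      have : 0 < p * (j + 1) := by positivity
      omega
    have e3 : p * (j + 1) - 1 = (p - 1) + p * j := by
      rw [mul_add, mul_one]; omega
    simp only [hd]
    rw [e, Nat.floor_natCast, Nat.ceil_natCast]
    nth_rw 1 [e2]
    rw [geo_succ, e3]
    ring
  rw [← hinj.tsum_eq hsupp]
  simp only [hval]
  rw [tsum_mul_left, tsum_geometric_of_lt_one (by positivity) hx, div_eq_mul_inv]

lemma Admissible.sigmaLeft_eq (hq : 0 < q) (hp : 0 < p) (hpq : p.Coprime q)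
    (h : Admissible lam mu ((p : ℝ) / q)) :
    lam * sigmaLeft lam mu p q
      = (1 - lam) * ∑' k : ℕ, geo lam mu k (⌈(k : ℝ) * (p / q)⌉₊ - 1) := by
  have h1 := h.sigma_eq
  have h2 := Admissible.floor_sub_ceil_tsum hq hp hpq h
  have h3 : lam * lam ^ (q - 1) = lam ^ q := by
    rw [← pow_succ', Nat.sub_add_cancel hq]
  have h4 : lam * (lam ^ (q - 1) * mu ^ (p - 1) * (1 - lam) / (1 - lam ^ q * mu ^ p))
      = (1 - lam) * (lam ^ q * mu ^ (p - 1) / (1 - lam ^ q * mu ^ p)) := by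
    rw [← h3]; ring
  rw [sigmaLeft, mul_sub, h1, h4, ← h2]
  ring

/-- `rMax` is the smaller of `1` and the angle `r` with `lam * mu ^ r = 1`, if there is one, so the
series converge at all angles below it. -/
lemma admissible_of_lt_rMax (hl : 0 < lam) (hl1 : lam < 1) (hm : 0 < mu) (hr : 0 < r)
    (hrm : r < rMax lam mu) : Admissible lam mu r := by
  have key : r < 1 ∧ lam * mu ^ r < 1 := by
    rw [rMax] at hrm
    split_ifs at hrm with hlm
    · refine ⟨hrm, ?_⟩
      rcases le_or_gt mu 1 with h1 | h1
      · have := Real.rpow_le_one hm.le h1 hr.le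
        nlinarith
      · have h2 : mu ^ r ≤ mu ^ (1 : ℝ) := Real.rpow_le_rpow_of_exponent_le h1.le hrm.le
        rw [Real.rpow_one] at h2
        nlinarith
    · have hlm' : 1 ≤ lam * mu := not_lt.1 hlm
      have h1 : 1 < mu := by nlinarith
      have hlog : 0 < Real.log mu := Real.log_pos h1
      have h2 : 0 ≤ Real.log lam + Real.log mu := by
        rw [← Real.log_mul hl.ne' hm.ne']; exact Real.log_nonneg hlm'
      have h3 : r * Real.log mu < -Real.log lam := by
        rw [← neg_div] at hrm
        exact (lt_div_iff₀ hlog).1 hrm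
      refine ⟨by nlinarith, ?_⟩
      have h4 : Real.log (lam * mu ^ r) < 0 := by
        rw [Real.log_mul hl.ne' (Real.rpow_pos_of_pos hm r).ne', Real.log_rpow hm]; linarith
      by_contra h5
      exact absurd (Real.log_nonneg (not_lt.1 h5)) (not_le.2 h4)
  exact ⟨hl, hl1, hm, hr, key.1, key.2⟩

lemma Admissible.lt_rMax (h : Admissible lam mu r) : r < rMax lam mu := by
  obtain ⟨hl, hl1, hm, hr, hr1, hc⟩ := h
  rw [rMax]
  split_ifs with hlm
  · exact hr1
  · have h1 : 1 < mu := by nlinarith [not_lt.1 hlm]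
    have hlog : 0 < Real.log mu := Real.log_pos h1
    rw [← neg_div, lt_div_iff₀ hlog]
    have h4 : Real.log (lam * mu ^ r) < 0 :=
      Real.log_neg (mul_pos hl (Real.rpow_pos_of_pos hm r)) hc
    rw [Real.log_mul hl.ne' (Real.rpow_pos_of_pos hm r).ne', Real.log_rpow hm] at h4
    linarith

/-- Just to the left of `p / q`, the integer part of `k r` is the largest integer strictly below
`k p / q`. -/
lemma tendsto_sigma_left (hq : 0 < q) (hp : 0 < p) (hpq : p.Coprime q)
    (h : Admissible lam mu ((p : ℝ) / q)) :
    Tendsto (fun r => sigma lam mu r) (𝓝[<] ((p : ℝ) / q)) (𝓝 (sigmaLeft lam mu p q)) := by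
  have hl := h.lam_pos
  have hr := h.r_pos
  have hrm := h.lt_rMax
  have hIoo : ∀ᶠ r in 𝓝[<] ((p : ℝ) / q), 0 < r ∧ r < (p : ℝ) / q := by
    filter_upwards [self_mem_nhdsWithin, nhdsWithin_le_nhds (Ioi_mem_nhds hr)] with r h1 h2
    exact ⟨h2, h1⟩
  have h1 : Tendsto (fun r : ℝ => ∑' k : ℕ, geo lam mu k ⌊(k : ℝ) * r⌋₊) (𝓝[<] ((p : ℝ) / q))
      (𝓝 (∑' k : ℕ, geo lam mu k (⌈(k : ℝ) * (p / q)⌉₊ - 1))) := by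
    refine h.tendsto_geo_tsum (N := fun r k => ⌊(k : ℝ) * r⌋₊) ?_ fun k => ?_
    · filter_upwards [hIoo] with r hr' k
      have a : (k : ℝ) * r ≤ k * (p / q) := mul_le_mul_of_nonneg_left hr'.2.le (by positivity)
      have := hr'.1
      linarith [Nat.floor_le (show 0 ≤ (k : ℝ) * r by positivity)]
    · rcases Nat.eq_zero_or_pos k with rfl | hk
      · simp
      have hk' : (0 : ℝ) < k := by exact_mod_cast hk
      have hpos : 0 < (k : ℝ) * (p / q) := by positivity
      have hc : 0 < ⌈(k : ℝ) * (p / q)⌉₊ := Nat.ceil_pos.2 hpos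
      obtain ⟨c1, c2⟩ := (Nat.ceil_eq_iff hc.ne').1 rfl
      have hev : ∀ᶠ r in 𝓝[<] ((p : ℝ) / q), ((⌈(k : ℝ) * (p / q)⌉₊ - 1 : ℕ) : ℝ) / k < r :=
        nhdsWithin_le_nhds (Ioi_mem_nhds (by rw [div_lt_iff₀ hk']; linarith))
      filter_upwards [hIoo, hev] with r hr1 hr2
      rw [div_lt_iff₀ hk'] at hr2
      have a : (k : ℝ) * r < k * (p / q) := mul_lt_mul_of_pos_left hr1.2 hk'
      have := hr1.1
      rw [Nat.floor_eq_iff (by positivity)]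
      refine ⟨by linarith, ?_⟩
      have : ((⌈(k : ℝ) * (p / q)⌉₊ - 1 : ℕ) : ℝ) + 1 = (⌈(k : ℝ) * (p / q)⌉₊ : ℝ) := by
        exact_mod_cast Nat.sub_add_cancel hc
      linarith
  have h2 : Tendsto (fun r : ℝ => (1 - lam) / lam * ∑' k : ℕ, geo lam mu k ⌊(k : ℝ) * r⌋₊)
      (𝓝[<] ((p : ℝ) / q)) (𝓝 (sigmaLeft lam mu p q)) := by
    have e : sigmaLeft lam mu p q
        = (1 - lam) / lam * ∑' k : ℕ, geo lam mu k (⌈(k : ℝ) * (p / q)⌉₊ - 1) := by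
      have := Admissible.sigmaLeft_eq hq hp hpq h
      rw [div_mul_eq_mul_div, eq_div_iff hl.ne']
      linarith
    rw [e]
    exact h1.const_mul _
  refine h2.congr' ?_
  filter_upwards [hIoo] with r hr'
  have := (admissible_of_lt_rMax hl h.lam_lt h.mu_pos hr'.1 (hr'.2.trans hrm)).sigma_eq
  rw [div_mul_eq_mul_div, div_eq_iff hl.ne']
  linarith

lemma tendsto_aFun_left {b c : ℝ} (hq : 0 < q) (hp : 0 < p) (hpq : p.Coprime q)
    (h : Admissible lam mu ((p : ℝ) / q)) :
    Tendsto (fun r => aFun lam mu b c r) (𝓝[<] ((p : ℝ) / q)) (𝓝 (aLeft lam mu b c p q)) := by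
  have hs := tendsto_sigma_left hq hp hpq h
  have hden : 1 + (mu - 1) * sigmaLeft lam mu p q ≠ 0 := by
    refine (h.denom_pos (N := fun k => ⌈(k : ℝ) * (p / q)⌉₊ - 1) (by simp) (fun k => ?_)
      (Admissible.sigmaLeft_eq hq hp hpq h)).ne'
    have a1 : ((⌈(k : ℝ) * (p / q)⌉₊ - 1 : ℕ) : ℝ) ≤ (⌈(k : ℝ) * (p / q)⌉₊ : ℝ) := by
      exact_mod_cast Nat.sub_le _ _
    have a2 := Nat.ceil_lt_add_one (show 0 ≤ (k : ℝ) * ((p : ℝ) / q) by positivity)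
    linarith
  simp only [aFun, aLeft, aOfSigma]
  exact ((hs.const_mul _).const_add _).const_mul _ |>.div ((hs.const_mul _).const_add _) hden

end Sigma

/-! ### Integer sequences close to a line -/

section Sequences

/-- The forward orbit of a point under an irrational rotation returns to every interval at
arbitrarily late times. -/
lemma fract_add_nat_mul_mem_Ioo {r : ℝ} (hr : Irrational r) (y₀ : ℝ) {α β : ℝ} (hα : 0 ≤ α)
    (hαβ : α < β) (hβ : β ≤ 1) (N : ℕ) : ∃ n, N ≤ n ∧ Int.fract (y₀ + n * r) ∈ Ioo α β := by
  have hd : DenseRange ((· • (r : AddCircle (1 : ℝ))) : ℕ → AddCircle (1 : ℝ)) :=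
    denseRange_zsmul_iff_nsmul.1 (AddCircle.denseRange_zsmul_coe_iff.2 (by simpa using hr))
  set y' := y₀ + N * r with hy'
  have hopen : IsOpen ((fun t : ℝ => (t : AddCircle (1 : ℝ))) '' Ioo (α - y') (β - y')) :=
    QuotientAddGroup.isOpenMap_coe _ isOpen_Ioo
  obtain ⟨n, t, ht, hn⟩ := hd.exists_mem_open hopen
    ((nonempty_Ioo.2 (by linarith)).image _)
  have hn' : ((t : ℝ) : AddCircle (1 : ℝ)) = ((n * r : ℝ) : AddCircle (1 : ℝ)) := by
    rw [← nsmul_eq_mul]; exact hn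
  obtain ⟨z, hz⟩ := (AddCircle.coe_eq_zero_iff (1 : ℝ)).1
    (show (((n * r - t : ℝ)) : AddCircle (1 : ℝ)) = 0 by rw [AddCircle.coe_sub, hn', sub_self])
  rw [zsmul_eq_mul, mul_one] at hz
  refine ⟨N + n, by omega, ?_⟩
  have hf : Int.fract (y₀ + ((N + n : ℕ) : ℝ) * r) = y' + t := by
    rw [Int.fract_eq_iff]
    refine ⟨by linarith [ht.1], by linarith [ht.2], z, ?_⟩
    rw [hz, hy']; push_cast; ring
  rw [hf]
  exact ⟨by linarith [ht.1], by linarith [ht.2]⟩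

/-- A monotone sequence of integers that is bounded above is eventually constant. -/
lemma exists_eventually_const {B : ℕ → ℤ} (hB : Monotone B) {K : ℤ} (hK : ∀ n, B n ≤ K) :
    ∃ N, ∀ n, N ≤ n → B n = B N := by
  obtain ⟨m, ⟨N, hN⟩, hm⟩ := Int.exists_greatest_of_bdd (P := fun z => ∃ n, B n = z)
    ⟨K, fun z ⟨n, hn⟩ => hn ▸ hK n⟩ ⟨B 0, 0, rfl⟩
  exact ⟨N, fun n hn => le_antisymm (hN ▸ hm _ ⟨n, rfl⟩) (hB hn)⟩

/-- If `S` stays close to the line of slope `θ`, where `q θ` is an integer, and the increments of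
`S` over time `q` eventually stay on one side of `q θ`, then they are eventually equal to it. -/
lemma eventually_add_eq {S : ℕ → ℤ} {θ : ℝ} {q : ℕ} {P : ℤ} (hP : (q : ℝ) * θ = P)
    (H : ∀ m n : ℕ, |((S m : ℝ) - m * θ) - (S n - n * θ)| ≤ 1) {n₀ : ℕ}
    (hs : ∀ n, n₀ ≤ n → S n + P ≤ S (n + q)) : ∃ N, ∀ n, N ≤ n → S (n + q) = S n + P := by
  -- sums over windows of length `q` telescope: they change by `S (n + q) - S n - P`
  set B : ℕ → ℤ := fun n => ∑ i ∈ Finset.range q, S (n₀ + n + i) - n * P with hB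
  have hstep : ∀ n, B (n + 1) = B n + (S (n₀ + n + q) - (S (n₀ + n) + P)) := by
    intro n
    have h1 : ∑ i ∈ Finset.range q, S (n₀ + n + (i + 1)) + S (n₀ + n + 0)
        = ∑ i ∈ Finset.range q, S (n₀ + n + i) + S (n₀ + n + q) := by
      rw [← Finset.sum_range_succ' (fun i => S (n₀ + n + i)), Finset.sum_range_succ]
    have h2 : ∑ i ∈ Finset.range q, S (n₀ + (n + 1) + i)
        = ∑ i ∈ Finset.range q, S (n₀ + n + (i + 1)) :=
      Finset.sum_congr rfl fun i _ => by congr 1; ring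
    simp only [hB, h2]
    push_cast
    simp only [add_zero] at h1
    linarith
  have hmono : Monotone B := monotone_nat_of_le_succ fun n => by
    rw [hstep]; linarith [hs (n₀ + n) (by omega)]
  have hbd : ∀ n, (B n : ℝ) ≤ ∑ i ∈ Finset.range q, ((S 0 : ℝ) + 1 + (n₀ + i) * θ) := by
    intro n
    have h1 : ((n : ℝ) * P) = ∑ i ∈ Finset.range q, (n : ℝ) * θ := by
      rw [Finset.sum_const, Finset.card_range, nsmul_eq_mul, ← hP]; ring
    simp only [hB]
    push_cast
    rw [h1, ← Finset.sum_sub_distrib]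
    refine Finset.sum_le_sum fun i _ => ?_
    have h2 := (abs_le.1 (H (n₀ + n + i) 0)).2
    push_cast at h2
    linarith
  obtain ⟨N, hN⟩ := exists_eventually_const hmono (K := ⌊∑ i ∈ Finset.range q,
    ((S 0 : ℝ) + 1 + (n₀ + i) * θ)⌋) fun n => Int.le_floor.2 (hbd n)
  refine ⟨n₀ + N, fun n hn => ?_⟩
  obtain ⟨k, rfl⟩ := Nat.exists_eq_add_of_le hn
  have h1 := hN (N + k) (by omega)
  have h2 := hN (N + k + 1) (by omega)
  rw [hstep, h1, ← add_assoc] at h2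
  linarith

/-- A sequence of integers within bounded distance of a line is, from some index on, the sequence of
integer parts along a parallel line. If the slope `θ` is rational this needs the increments over
each period to have an eventually constant sign; then the line can be chosen through a lattice
point. -/
lemma exists_floor_line {S : ℕ → ℤ} {θ : ℝ}
    (H : ∀ m n : ℕ, |((S m : ℝ) - m * θ) - (S n - n * θ)| ≤ 1)
    (hsign : ∀ q : ℕ, ∀ P : ℤ, (q : ℝ) * θ = P →
      (∃ n₀, ∀ n, n₀ ≤ n → S n + P ≤ S (n + q)) ∨ ∃ n₀, ∀ n, n₀ ≤ n → S (n + q) ≤ S n + P) :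
    ∃ y : ℝ, ∃ N : ℕ, (∀ n : ℕ, N ≤ n → ⌊y + n * θ⌋ = S n) ∧
      ∀ q : ℕ, ∀ P : ℤ, (q : ℝ) * θ = P → ∃ z : ℤ, q * y = z := by
  by_cases hθ : Irrational θ
  · set Z : ℕ → ℝ := fun n => (S n : ℝ) - n * θ with hZ
    have hbdd : BddAbove (range Z) := ⟨Z 0 + 1, by
      rintro _ ⟨n, rfl⟩; linarith [(abs_le.1 (H n 0)).2]⟩
    set y := ⨆ n, Z n with hy
    have h1 : ∀ n, Z n ≤ y := fun n => le_ciSup hbdd n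
    have h2 : ∀ n, y ≤ Z n + 1 := fun n => ciSup_le fun m => by
      linarith [(abs_le.1 (H m n)).2]
    -- `y + n θ = S n + 1` holds for at most one `n`, as two such `n` would make `θ` rational
    have huniq : ∀ m n, y = Z m + 1 → y = Z n + 1 → m = n := by
      intro m n hm hn
      by_contra hne
      have e : ((m : ℤ) - n : ℤ) * θ = ((S m - S n : ℤ) : ℝ) := by
        push_cast
        simp only [hZ] at hm hn
        linarith
      exact (hθ.intCast_mul (sub_ne_zero.2 (by exact_mod_cast hne))).ne_int _ e
    have hN : ∃ N, ∀ n, N ≤ n → y ≠ Z n + 1 := by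
      by_cases hex : ∃ m, y = Z m + 1
      · obtain ⟨m, hm⟩ := hex
        exact ⟨m + 1, fun n hn h => by have := huniq m n hm h; omega⟩
      · exact ⟨0, fun n _ h => hex ⟨n, h⟩⟩
    obtain ⟨N, hN⟩ := hN
    refine ⟨y, N, fun n hn => ?_, fun q P hP => ?_⟩
    · have a1 := h1 n
      have a2 := lt_of_le_of_ne (h2 n) (hN n hn)
      simp only [hZ] at a1 a2
      rw [Int.floor_eq_iff]
      constructor <;> linarith
    · rcases Nat.eq_zero_or_pos q with rfl | hq
      · exact ⟨0, by simp⟩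
      · exact absurd hP ((hθ.natCast_mul hq.ne').ne_int P)
  · obtain ⟨t, ht⟩ : ∃ t : ℚ, (t : ℝ) = θ := by
      simpa [Irrational] using hθ
    set q := t.den with hqdef
    have hq : 0 < q := t.den_pos
    have hP : (q : ℝ) * θ = (t.num : ℤ) := by
      rw [← ht]
      exact_mod_cast Rat.den_mul_eq_num t
    have hdvd : ∀ k z : ℤ, (k : ℝ) * θ = z → (q : ℤ) ∣ k := by
      intro k z hk
      have e : k * t.num = z * q := by
        have : (k : ℝ) * t.num = z * q := by rw [← hk, ← hP]; ring
        exact_mod_cast this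
      have hcop : IsCoprime (q : ℤ) t.num := by
        rw [Int.isCoprime_iff_nat_coprime]
        simpa using t.reduced.symm
      exact hcop.dvd_of_dvd_mul_right ⟨z, by rw [e, mul_comm]⟩
    obtain ⟨N, hN⟩ : ∃ N, ∀ n, N ≤ n → S (n + q) = S n + t.num := by
      rcases hsign q t.num hP with ⟨n₀, h⟩ | ⟨n₀, h⟩
      · exact eventually_add_eq hP H h
      · obtain ⟨N, hN⟩ := eventually_add_eq (S := fun n => - S n) (θ := -θ) (q := q) (P := -t.num)
          (n₀ := n₀) (by push_cast; linarith)
          (fun m n => by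
            rw [← abs_neg]
            refine le_trans (le_of_eq ?_) (H m n)
            congr 1
            push_cast
            ring)
          (fun n hn => by linarith [h n hn])
        exact ⟨N, fun n hn => by linarith [hN n hn]⟩
    set Z : ℕ → ℝ := fun n => (S n : ℝ) - n * θ with hZ
    have hper : ∀ n, N ≤ n → ∀ j : ℕ, Z (n + q * j) = Z n := by
      intro n hn j
      induction j with
      | zero => simp
      | succ j ih =>
        rw [← ih, mul_add, mul_one, ← add_assoc]
        simp only [hZ]
        rw [hN _ (by omega)]
        push_cast
        rw [← hP]
        ring
    have hred : ∀ n, N ≤ n → Z n = Z (N + (n - N) % q) := by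
      intro n hn
      rw [← hper (N + (n - N) % q) (by omega) ((n - N) / q), add_assoc, Nat.mod_add_div]
      congr 1
      omega
    -- the supremum of `S n - n θ` over `n ≥ N` is attained within one period
    obtain ⟨i₀, -, hmax⟩ := Finset.exists_max_image (Finset.range q) (fun i => Z (N + i))
      ⟨0, Finset.mem_range.2 hq⟩
    refine ⟨Z (N + i₀), N, fun n hn => ?_, fun q' P' hP' => ?_⟩
    · have a1 : Z n ≤ Z (N + i₀) := by
        rw [hred n hn]
        exact hmax _ (Finset.mem_range.2 (Nat.mod_lt _ hq))
      have a2 : Z (N + i₀) ≤ Z n + 1 := by linarith [(abs_le.1 (H (N + i₀) n)).2]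
      -- the difference is an integer only if the indices agree modulo `q`, and then it is zero
      have a3 : Z (N + i₀) ≠ Z n + 1 := by
        intro h
        have e : (((N + i₀ : ℕ) : ℤ) - n : ℤ) * θ = ((S (N + i₀) - S n - 1 : ℤ) : ℝ) := by
          simp only [hZ] at h
          push_cast at h ⊢
          linarith
        obtain ⟨z, hz⟩ := hdvd _ _ e
        have : Z (N + i₀) = Z n := by
          rcases le_total 0 z with h0 | h0
          · lift z to ℕ using h0
            have : N + i₀ = n + q * z := by zify; push_cast at hz; linarith
            rw [this, hper n hn]
          · obtain ⟨w, rfl⟩ : ∃ w : ℕ, z = -w := ⟨(-z).toNat, by omega⟩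
            have : n = (N + i₀) + q * w := by zify; push_cast at hz; linarith
            rw [this, hper _ (by omega)]
        linarith
      have a4 := lt_of_le_of_ne a2 a3
      rw [Int.floor_eq_iff]
      constructor
      · simp only [hZ] at a1 ⊢; linarith
      · simp only [hZ] at a4 ⊢; linarith
    · refine ⟨q' * S (N + i₀) - (N + i₀ : ℕ) * P', ?_⟩
      simp only [hZ]
      push_cast
      rw [← hP']
      ring

lemma tendsto_div_of_abs_sub_le {u : ℕ → ℝ} {L C : ℝ} {M : ℕ}
    (hu : ∀ n, M ≤ n → |u n - n * L| ≤ C) : Tendsto (fun n => u n / n) atTop (𝓝 L) := by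
  have h1 : Tendsto (fun n : ℕ => C / (n : ℝ)) atTop (𝓝 0) :=
    tendsto_const_div_atTop_nhds_zero_nat C
  refine tendsto_iff_norm_sub_tendsto_zero.2
    (squeeze_zero' (Eventually.of_forall fun n => norm_nonneg _) ?_ h1)
  filter_upwards [eventually_ge_atTop (max M 1)] with n hn
  have hn0 : (0 : ℝ) < n := by exact_mod_cast (le_max_right _ _).trans hn
  rw [Real.norm_eq_abs, div_sub' hn0.ne', abs_div, abs_of_pos hn0]
  gcongr
  exact hu n ((le_max_left _ _).trans hn)

end Sequences

/-! ### The map on the absorbing interval -/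

variable {P : Params}

/-- The inequalities between the parameters that the dynamics uses: the break point lies strictly
between `c` and `b`, the left branch sends it to `b`, the image of `[c, b)` misses a nonempty gap,
the fixed point of the left branch lies to the right of `b`, and the right branch stays
below `1`. -/
structure Params.Facts (P : Params) : Prop where
  lam_pos : 0 < P.lam
  lam_lt : P.lam < 1
  mu_pos : 0 < P.mu
  c_nonneg : 0 ≤ P.c
  c_lt_b : P.c < P.b
  b_le : P.b ≤ 1
  c_lt_eta : P.c < P.eta
  eta_lt_b : P.eta < P.b
  a_eq : P.a = P.b - P.lam * P.eta
  gap : P.lam * P.mu * (P.b - P.eta) + P.c < P.lam * P.c + P.a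
  kap : P.b < P.a / (1 - P.lam)
  top : P.lam * P.mu * (1 - P.eta) + P.c < 1

lemma Params.facts (hP : P ∈ paramSet) : P.Facts := by
  obtain ⟨⟨hl, hl1⟩, hm, ⟨hc, hcb, hb⟩, hor, ⟨ha1, ha2⟩, hg⟩ := hP
  have he : P.lam * P.eta = P.b - P.a := by rw [Params.eta]; field_simp
  have hce : P.c < P.eta := by rw [Params.eta, lt_div_iff₀ hl]; linarith
  have heb : P.eta < P.b := by rw [Params.eta, div_lt_iff₀ hl]; linarith
  have hgap : P.lam * P.mu * (P.b - P.eta) + P.c < P.lam * P.c + P.a := by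
    have e : P.lam * P.mu * (P.b - P.eta) = P.lam * P.mu * P.b - P.mu * (P.lam * P.eta) := by ring
    rw [e, he]
    nlinarith
  refine ⟨hl, hl1, hm, hc, hcb, hb, hce, heb, by linarith, hgap, ?_, ?_⟩
  · rw [lt_div_iff₀ (by linarith)]; linarith
  · have hbb : P.lam * P.mu * (P.b - P.eta) + P.c < P.b := by nlinarith
    rcases le_or_gt (P.lam * P.mu) 1 with h1 | h1
    · nlinarith
    · have h2 : (1 - P.b) * P.mu ≤ 1 - P.c := hor.resolve_left (not_le.2 h1)
      have hm1 : 0 < P.mu - 1 := by nlinarith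
      -- the bound on `a` given by the gap condition is at most the one needed here
      have e : P.lam * P.mu * (1 - P.eta) = P.lam * P.mu - P.mu * (P.lam * P.eta) := by ring
      rw [e, he]
      have h3 : 0 ≤ (1 - (P.mu * (1 - P.b) + P.c)) * (P.lam * P.mu - 1) :=
        mul_nonneg (by linarith) (by linarith)
      have h4 : (P.mu - 1) * P.a < (1 - P.lam) * (P.mu * P.b - P.c) := by linarith
      have h5 : P.mu * ((P.mu - 1) * P.a) < P.mu * ((1 - P.lam) * (P.mu * P.b - P.c)) :=
        mul_lt_mul_of_pos_left h4 hm
      by_contra hcon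
      have h6 : 0 ≤ (P.mu - 1) * (P.lam * P.mu - P.mu * (P.b - P.a) + P.c - 1) :=
        mul_nonneg hm1.le (by linarith)
      nlinarith

/-- The interval `[c, b)`, which absorbs all orbits and on which `f` is injective. -/
def Params.J (P : Params) : Set ℝ := Ico P.c P.b

/-- The number of visits of `x, f x, …, f^[n - 1] x` to the right branch of `f`. -/
noncomputable def Params.visits (P : Params) : ℕ → ℝ → ℕ
  | 0, _ => 0
  | n + 1, x => Params.visits P n x + if P.f^[n] x < P.eta then 0 else 1

lemma Params.visits_add (m n : ℕ) (x : ℝ) :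
    P.visits (m + n) x = P.visits m x + P.visits n (P.f^[m] x) := by
  induction n with
  | zero => simp [Params.visits]
  | succ n ih =>
    rw [← add_assoc, Params.visits, Params.visits, ih, add_comm m n,
      Function.iterate_add_apply, add_assoc]

lemma Params.f_left {x : ℝ} (hx : x < P.eta) : P.f x = P.lam * x + P.a := if_pos hx

lemma Params.f_right {x : ℝ} (hx : P.eta ≤ x) :
    P.f x = P.lam * P.mu * (x - P.eta) + P.c := if_neg (not_lt.2 hx)

namespace Params.Facts

lemma J_subset (h : P.Facts) : P.J ⊆ I := fun _ hx =>
  ⟨h.c_nonneg.trans hx.1, hx.2.trans_le h.b_le⟩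

lemma c_mem (h : P.Facts) : P.c ∈ P.J := ⟨le_rfl, h.c_lt_b⟩

lemma slope_pos (h : P.Facts) : 0 < P.lam * P.mu := mul_pos h.lam_pos h.mu_pos

lemma a_pos (h : P.Facts) : 0 < P.a := by
  have := h.lam_pos; have := h.lam_lt; have := h.eta_lt_b; have := h.c_lt_eta
  have := h.c_nonneg; have := h.a_eq
  nlinarith

lemma f_left_lt (h : P.Facts) {x : ℝ} (hx : x < P.eta) : P.lam * x + P.a < P.b := by
  have := h.lam_pos; have := h.a_eq; nlinarith

lemma lam_c_add_a_ge (h : P.Facts) : P.c < P.lam * P.c + P.a := by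
  have h1 := h.gap
  have h2 : 0 < P.lam * P.mu * (P.b - P.eta) := mul_pos h.slope_pos (by linarith [h.eta_lt_b])
  linarith

lemma f_right_lt (h : P.Facts) {x : ℝ} (hx : x < P.b) :
    P.lam * P.mu * (x - P.eta) + P.c < P.lam * P.c + P.a := by
  have h1 : P.lam * P.mu * (x - P.eta) < P.lam * P.mu * (P.b - P.eta) :=
    mul_lt_mul_of_pos_left (by linarith) h.slope_pos
  linarith [h.gap]

lemma mapsTo_I (h : P.Facts) : MapsTo P.f I I := by
  rintro x ⟨hx0, hx1⟩
  rcases lt_or_ge x P.eta with hx | hx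
  · rw [f_left hx]
    have := h.f_left_lt hx; have := h.a_pos; have := h.lam_pos; have := h.b_le
    exact ⟨by positivity, by linarith⟩
  · rw [f_right hx]
    have h1 : 0 ≤ P.lam * P.mu * (x - P.eta) := mul_nonneg h.slope_pos.le (by linarith)
    have h2 : P.lam * P.mu * (x - P.eta) < P.lam * P.mu * (1 - P.eta) :=
      mul_lt_mul_of_pos_left (by linarith) h.slope_pos
    exact ⟨by linarith [h.c_nonneg], by linarith [h.top]⟩

lemma mapsTo_J (h : P.Facts) : MapsTo P.f P.J P.J := by
  rintro x ⟨hx0, hx1⟩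
  rcases lt_or_ge x P.eta with hx | hx
  · rw [f_left hx]
    have h1 : P.lam * P.c ≤ P.lam * x := mul_le_mul_of_nonneg_left hx0 h.lam_pos.le
    exact ⟨by linarith [h.lam_c_add_a_ge], h.f_left_lt hx⟩
  · rw [f_right hx]
    have h1 : 0 ≤ P.lam * P.mu * (x - P.eta) := mul_nonneg h.slope_pos.le (by linarith)
    have h2 := h.f_right_lt hx1
    have h3 := h.f_left_lt h.c_lt_eta
    exact ⟨by linarith, by linarith⟩

lemma iterate_mem_I (h : P.Facts) {x : ℝ} (hx : x ∈ I) (n : ℕ) : P.f^[n] x ∈ I :=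
  h.mapsTo_I.iterate n hx

lemma iterate_mem_J (h : P.Facts) {x : ℝ} (hx : x ∈ P.J) (n : ℕ) : P.f^[n] x ∈ P.J :=
  h.mapsTo_J.iterate n hx

lemma injOn_J (h : P.Facts) : InjOn P.f P.J := by
  intro x hx y hy hxy
  have hl := h.lam_pos
  have hs := h.slope_pos
  have key : ∀ u v : ℝ, u ∈ P.J → v ∈ P.J → u < P.eta → P.eta ≤ v → P.f u ≠ P.f v := by
    intro u v hu hv h1 h2
    rw [f_left h1, f_right h2]
    have := h.f_right_lt hv.2
    have : P.lam * P.c ≤ P.lam * u := mul_le_mul_of_nonneg_left hu.1 hl.le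
    linarith
  rcases lt_or_ge x P.eta with h1 | h1 <;> rcases lt_or_ge y P.eta with h2 | h2
  · rw [f_left h1, f_left h2] at hxy
    exact mul_left_cancel₀ hl.ne' (by linarith)
  · exact absurd hxy (key x y hx hy h1 h2)
  · exact absurd hxy.symm (key y x hy hx h2 h1)
  · rw [f_right h1, f_right h2] at hxy
    have := mul_left_cancel₀ hs.ne' (show P.lam * P.mu * (x - P.eta)
      = P.lam * P.mu * (y - P.eta) by linarith)
    linarith

/-- All orbits of `I` enter `[c, b)` within a common time. -/
lemma exists_entry (h : P.Facts) : ∃ M, ∀ x ∈ I, P.f^[M] x ∈ P.J := by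
  have hl := h.lam_pos
  have hl1 := h.lam_lt
  have hs := h.slope_pos
  have hbb : P.lam * P.mu * (P.b - P.eta) + P.c < P.b :=
    h.gap.trans (h.f_left_lt h.c_lt_eta)
  -- outside `[c, b)` every step moves towards it by at least `e`
  obtain ⟨e, he, he1, he2, he3⟩ : ∃ e : ℝ, 0 < e ∧ e ≤ P.a - (1 - P.lam) * P.c ∧
      P.lam * P.mu * (P.b - P.eta) + P.c ≤ P.b - e ∧
      P.lam * P.mu * (1 - P.eta) + P.c ≤ 1 - e := by
    refine ⟨min (P.a - (1 - P.lam) * P.c) (min (P.b - (P.lam * P.mu * (P.b - P.eta) + P.c))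
      (1 - (P.lam * P.mu * (1 - P.eta) + P.c))), ?_, min_le_left _ _, ?_, ?_⟩
    · exact lt_min (by linarith [h.lam_c_add_a_ge]) (lt_min (by linarith) (by linarith [h.top]))
    · linarith [(min_le_right (P.a - (1 - P.lam) * P.c) _).trans
        (min_le_left (P.b - (P.lam * P.mu * (P.b - P.eta) + P.c))
          (1 - (P.lam * P.mu * (1 - P.eta) + P.c)))]
    · linarith [(min_le_right (P.a - (1 - P.lam) * P.c) _).trans
        (min_le_right (P.b - (P.lam * P.mu * (P.b - P.eta) + P.c))
          (1 - (P.lam * P.mu * (1 - P.eta) + P.c)))]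
  have hlow : ∀ x, x < P.c → x + e ≤ P.f x ∧ P.f x < P.b := by
    intro x hx
    have hx' := hx.trans h.c_lt_eta
    rw [f_left hx']
    exact ⟨by nlinarith, h.f_left_lt hx'⟩
  have hhigh : ∀ x, P.b ≤ x → x < 1 → P.c ≤ P.f x ∧ P.f x ≤ x - e := by
    intro x hx hx1
    have hx' := h.eta_lt_b.le.trans hx
    rw [f_right hx']
    refine ⟨by nlinarith, ?_⟩
    -- the displacement is affine, so it is controlled by its values at `b` and at `1`
    rcases le_or_gt (P.lam * P.mu) 1 with h1 | h1 <;> nlinarith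
  have key : ∀ n : ℕ, ∀ x ∈ I, P.f^[n] x ∈ P.J ∨ (P.f^[n] x < P.c ∧ n * e ≤ P.f^[n] x) ∨
      (P.b ≤ P.f^[n] x ∧ P.f^[n] x ≤ 1 - n * e) := by
    intro n x hx
    induction n with
    | zero =>
      simp only [Function.iterate_zero, id, Nat.cast_zero, zero_mul, sub_zero]
      rcases lt_or_ge x P.c with h1 | h1
      · exact Or.inr (Or.inl ⟨h1, hx.1⟩)
      · rcases lt_or_ge x P.b with h2 | h2
        · exact Or.inl ⟨h1, h2⟩
        · exact Or.inr (Or.inr ⟨h2, hx.2.le⟩)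
    | succ n ih =>
      rw [Function.iterate_succ_apply']
      have hI := h.iterate_mem_I hx n
      set z := P.f^[n] x
      push_cast
      rcases ih with h1 | ⟨h1, h2⟩ | ⟨h1, h2⟩
      · exact Or.inl (h.mapsTo_J h1)
      · obtain ⟨h3, h4⟩ := hlow z h1
        rcases lt_or_ge (P.f z) P.c with h5 | h5
        · exact Or.inr (Or.inl ⟨h5, by linarith⟩)
        · exact Or.inl ⟨h5, h4⟩
      · obtain ⟨h3, h4⟩ := hhigh z h1 hI.2
        rcases lt_or_ge (P.f z) P.b with h5 | h5
        · exact Or.inl ⟨h3, h5⟩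
        · exact Or.inr (Or.inr ⟨h5, by linarith⟩)
  obtain ⟨M, hM⟩ := exists_nat_gt (1 / e)
  rw [div_lt_iff₀ he] at hM
  refine ⟨M, fun x hx => ?_⟩
  rcases key M x hx with h1 | ⟨h1, h2⟩ | ⟨h1, h2⟩
  · exact h1
  · linarith [h.c_lt_b, h.b_le]
  · linarith [h.c_lt_b, h.c_nonneg]

end Params.Facts

/-! ### The lift and the rotation number -/

/-- One step of the lift of `f` on `[c, b)`, in the coordinate `t` with `x = c + (b - c) t`. -/
noncomputable def Params.step (P : Params) (x : ℝ) : ℝ :=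
  (P.f x - P.c) / (P.b - P.c) + if x < P.eta then 0 else 1

/-- The `n`-th point of the lifted orbit of `x`, in the coordinate `t` with `x = c + (b - c) t`. -/
noncomputable def Params.pos (P : Params) (n : ℕ) (x : ℝ) : ℝ :=
  (P.f^[n] x - P.c) / (P.b - P.c) + P.visits n x

namespace Params.Facts

lemma len_pos (h : P.Facts) : 0 < P.b - P.c := by linarith [h.c_lt_b]

lemma coord_mem (h : P.Facts) {x : ℝ} (hx : x ∈ P.J) : (x - P.c) / (P.b - P.c) ∈ Ico (0 : ℝ) 1 :=
  ⟨div_nonneg (by linarith [hx.1]) h.len_pos.le, by rw [div_lt_one h.len_pos]; linarith [hx.2]⟩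

lemma point_mem (h : P.Facts) (t : ℝ) : P.c + (P.b - P.c) * Int.fract t ∈ P.J := by
  have h1 := Int.fract_nonneg t
  have h2 := Int.fract_lt_one t
  have h3 := h.len_pos
  exact ⟨by nlinarith, by nlinarith⟩

lemma step_mono (h : P.Facts) {x y : ℝ} (hx : x ∈ P.J) (hy : y ∈ P.J) (hxy : x ≤ y) :
    P.step x ≤ P.step y := by
  have hl := h.len_pos
  rcases lt_or_ge y P.eta with h1 | h1
  · rw [Params.step, Params.step, if_pos h1, if_pos (hxy.trans_lt h1), f_left h1,
      f_left (hxy.trans_lt h1)]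
    have := h.lam_pos
    gcongr
  · rcases lt_or_ge x P.eta with h2 | h2
    · have h3 := (h.coord_mem (h.mapsTo_J hx)).2
      have h4 := (h.coord_mem (h.mapsTo_J hy)).1
      rw [Params.step, Params.step, if_neg (not_lt.2 h1), if_pos h2]
      linarith
    · rw [Params.step, Params.step, if_neg (not_lt.2 h1), if_neg (not_lt.2 h2), f_right h1,
        f_right h2]
      have := h.slope_pos.le
      gcongr

lemma step_le (h : P.Facts) {x : ℝ} (hx : x ∈ P.J) : P.step x ≤ P.step P.c + 1 := by
  have hl := h.len_pos
  rw [Params.step, Params.step, if_pos h.c_lt_eta, f_left h.c_lt_eta]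
  rcases lt_or_ge x P.eta with h1 | h1
  · rw [if_pos h1]
    have h3 := (h.coord_mem (h.mapsTo_J hx)).2
    have h4 := (h.coord_mem (h.mapsTo_J h.c_mem)).1
    rw [f_left h.c_lt_eta] at h4
    linarith
  · rw [if_neg (not_lt.2 h1), f_right h1]
    have h5 := h.f_right_lt hx.2
    have : (P.lam * P.mu * (x - P.eta) + P.c - P.c) / (P.b - P.c)
        ≤ (P.lam * P.c + P.a - P.c) / (P.b - P.c) := by gcongr
    linarith

/-- The lift of `f` restricted to the circle `[c, b)`: a monotone map of degree one. -/
noncomputable def lift (h : P.Facts) : CircleDeg1Lift where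
  toFun t := ⌊t⌋ + P.step (P.c + (P.b - P.c) * Int.fract t)
  monotone' s t hst := by
    dsimp only
    rcases (Int.floor_mono hst).eq_or_lt with h1 | h1
    · have h2 : Int.fract s ≤ Int.fract t := by
        rw [Int.fract, Int.fract, h1]; linarith
      have := h.step_mono (h.point_mem s) (h.point_mem t)
        (by nlinarith [h.len_pos])
      rw [h1]
      linarith
    · have h2 : (⌊s⌋ : ℝ) + 1 ≤ ⌊t⌋ := by exact_mod_cast h1
      have h3 := h.step_le (h.point_mem s)
      have h4 := h.step_mono h.c_mem (h.point_mem t) (h.point_mem t).1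
      linarith
  map_add_one' t := by
    rw [Int.floor_add_one, Int.fract_add_one]; push_cast; ring

lemma lift_apply (h : P.Facts) (t : ℝ) :
    h.lift t = ⌊t⌋ + P.step (P.c + (P.b - P.c) * Int.fract t) := rfl

lemma lift_coord (h : P.Facts) {x : ℝ} (hx : x ∈ P.J) (m : ℤ) :
    h.lift ((x - P.c) / (P.b - P.c) + m) = P.step x + m := by
  obtain ⟨h1, h2⟩ := h.coord_mem hx
  have hl := h.len_pos
  have hf : ⌊(x - P.c) / (P.b - P.c)⌋ = 0 := Int.floor_eq_zero_iff.2 ⟨h1, h2⟩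
  rw [h.lift.map_add_int, lift_apply, hf, Int.fract_eq_self.2 ⟨h1, h2⟩]
  rw [mul_div_cancel₀ _ hl.ne', add_sub_cancel]
  ring

lemma lift_pos (h : P.Facts) {x : ℝ} (hx : x ∈ P.J) (n : ℕ) :
    h.lift (P.pos n x) = P.pos (n + 1) x := by
  have := h.lift_coord (h.iterate_mem_J hx n) (P.visits n x)
  rw [Params.pos, Params.pos, Params.visits, Function.iterate_succ_apply']
  push_cast at this ⊢
  rw [this, Params.step]
  ring

lemma lift_pow_coord (h : P.Facts) {x : ℝ} (hx : x ∈ P.J) (n : ℕ) :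
    (h.lift ^ n) ((x - P.c) / (P.b - P.c)) = P.pos n x := by
  induction n with
  | zero => simp [Params.pos, Params.visits]
  | succ n ih => rw [pow_succ', CircleDeg1Lift.mul_apply, ih, h.lift_pos hx]

lemma pos_mem (h : P.Facts) {x : ℝ} (hx : x ∈ P.J) (n : ℕ) :
    (P.visits n x : ℝ) ≤ P.pos n x ∧ P.pos n x < P.visits n x + 1 := by
  have := h.coord_mem (h.iterate_mem_J hx n)
  rw [Params.pos]
  exact ⟨by linarith [this.1], by linarith [this.2]⟩

/-- The rotation number of `f` on `[c, b)`, as the translation number of its lift. -/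
noncomputable def rotNum (h : P.Facts) : ℝ := CircleDeg1Lift.translationNumber h.lift

/-- The number of visits is the integer part of the lifted orbit, which stays within distance one
of the line whose slope is the translation number. -/
lemma abs_visits_sub_le (h : P.Facts) {x : ℝ} (hx : x ∈ P.J) (n : ℕ) :
    |(P.visits n x : ℝ) - n * h.rotNum| ≤ 1 := by
  have h1 := h.pos_mem hx n
  have h2 := h.coord_mem hx
  have h3 := h.lift_pow_coord hx n
  have h4 : CircleDeg1Lift.translationNumber (h.lift ^ n) = n * h.rotNum :=
    CircleDeg1Lift.translationNumber_pow _ _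
  rw [abs_le]
  constructor
  · by_contra hcon
    have h5 : (((P.visits n x : ℤ) + 1 : ℤ) : ℝ)
        < CircleDeg1Lift.translationNumber (h.lift ^ n) := by
      rw [h4]; push_cast; linarith
    have h6 := (h.lift ^ n).lt_map_of_int_lt_translationNumber h5 ((x - P.c) / (P.b - P.c))
    rw [h3] at h6
    push_cast at h6
    linarith [h2.1]
  · by_contra hcon
    have h5 : CircleDeg1Lift.translationNumber (h.lift ^ n)
        < (((P.visits n x : ℤ) - 1 : ℤ) : ℝ) := by
      rw [h4]; push_cast; linarith
    have h6 := (h.lift ^ n).map_lt_of_translationNumber_lt_int h5 ((x - P.c) / (P.b - P.c))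
    rw [h3] at h6
    push_cast at h6
    linarith [h2.2]

/-- The displacement of the lift is bounded away from `0` and from `1`, hence so is its mean. -/
lemma rotNum_mem (h : P.Facts) : 0 < h.rotNum ∧ h.rotNum < 1 := by
  have hl := h.lam_pos
  have hl1 := h.lam_lt
  have hs := h.slope_pos
  have hlen := h.len_pos
  have hce := h.c_lt_eta
  have heb := h.eta_lt_b
  have hbb : P.lam * P.mu * (P.b - P.eta) + P.c < P.b :=
    h.gap.trans (h.f_left_lt h.c_lt_eta)
  have hcb := h.f_left_lt hce
  have hpos : 0 < P.lam * P.mu * (P.b - P.eta) := mul_pos hs (by linarith)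
  have red : ∀ t : ℝ, ∃ x ∈ P.J, h.lift t - t = P.step x - (x - P.c) / (P.b - P.c) := by
    intro t
    refine ⟨_, h.point_mem t, ?_⟩
    rw [lift_apply, add_sub_cancel_left, mul_div_cancel_left₀ _ hlen.ne', Int.fract]
    ring
  constructor
  · set e := min (P.b - P.eta) (P.lam * P.mu * (P.b - P.eta)) with he
    have he0 : 0 < e := lt_min (by linarith) hpos
    have he1 : e ≤ P.b - P.eta := min_le_left _ _
    have he2 : e ≤ P.lam * P.mu * (P.b - P.eta) := min_le_right _ _
    have hz : ∀ t, t + e / (P.b - P.c) ≤ h.lift t := by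
      intro t
      obtain ⟨x, hx, hxt⟩ := red t
      have key : e / (P.b - P.c) ≤ P.step x - (x - P.c) / (P.b - P.c) := by
        rw [Params.step]
        rcases lt_or_ge x P.eta with h1 | h1
        · rw [if_pos h1, f_left h1, add_zero, ← sub_div]
          have := h.a_eq
          gcongr
          nlinarith
        · rw [if_neg (not_lt.2 h1), f_right h1]
          have h2 : e ≤ P.lam * P.mu * (x - P.eta) + (P.b - P.c) - (x - P.c) := by
            have hx2 := hx.2
            rcases le_or_gt (P.lam * P.mu) 1 with h3 | h3 <;> nlinarith
          have e1 : (P.lam * P.mu * (x - P.eta) + P.c - P.c) / (P.b - P.c) + 1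
              - (x - P.c) / (P.b - P.c)
              = (P.lam * P.mu * (x - P.eta) + (P.b - P.c) - (x - P.c)) / (P.b - P.c) := by
            field_simp
            ring
          rw [e1]
          gcongr
      linarith
    exact lt_of_lt_of_le (by positivity) (h.lift.le_translationNumber_of_add_le hz)
  · set e := min (P.b - (P.lam * P.c + P.a)) (min (P.eta - P.c)
      (P.b - (P.lam * P.mu * (P.b - P.eta) + P.c))) with he
    have he0 : 0 < e := lt_min (by linarith) (lt_min (by linarith) (by linarith))
    have he1 : e ≤ P.b - (P.lam * P.c + P.a) := min_le_left _ _
    have he2 : e ≤ P.eta - P.c := (min_le_right _ _).trans (min_le_left _ _)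
    have he3 : e ≤ P.b - (P.lam * P.mu * (P.b - P.eta) + P.c) :=
      (min_le_right _ _).trans (min_le_right _ _)
    have hz : ∀ t, h.lift t ≤ t + (1 - e / (P.b - P.c)) := by
      intro t
      obtain ⟨x, hx, hxt⟩ := red t
      have key : P.step x - (x - P.c) / (P.b - P.c) ≤ 1 - e / (P.b - P.c) := by
        rw [Params.step]
        rcases lt_or_ge x P.eta with h1 | h1
        · rw [if_pos h1, f_left h1, add_zero, ← sub_div, le_sub_iff_add_le, ← add_div,
            div_le_one hlen]
          have hx1 := hx.1
          nlinarith
        · rw [if_neg (not_lt.2 h1), f_right h1]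
          have h2 : P.lam * P.mu * (x - P.eta) - (x - P.c) ≤ - e := by
            have hx2 := hx.2
            rcases le_or_gt (P.lam * P.mu) 1 with h3 | h3 <;> nlinarith
          have e1 : (P.lam * P.mu * (x - P.eta) + P.c - P.c) / (P.b - P.c) + 1
              - (x - P.c) / (P.b - P.c)
              = 1 + (P.lam * P.mu * (x - P.eta) - (x - P.c)) / (P.b - P.c) := by
            ring
          have e2 : (P.lam * P.mu * (x - P.eta) - (x - P.c)) / (P.b - P.c)
              ≤ (- e) / (P.b - P.c) := by gcongr
          rw [e1]
          rw [neg_div] at e2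
          linarith
      linarith
    have : 0 < e / (P.b - P.c) := by positivity
    have h5 := h.lift.translationNumber_le_of_le_add hz
    change CircleDeg1Lift.translationNumber h.lift < 1
    linarith

/-- The lift `F` on the whole line records the orbit of `f` and its visits to the right branch. It
need not be monotone outside the lifts of `[c, b)`. -/
lemma F_iterate (h : P.Facts) (x : ℝ) (n : ℕ) :
    P.F^[n] x = P.f^[n] (Int.fract x) + ⌊x⌋ + P.visits n (Int.fract x) := by
  induction n with
  | zero => simp [Params.visits, Int.fract_add_floor]
  | succ n ih =>
    rw [Function.iterate_succ_apply', ih, Function.iterate_succ_apply', Params.visits]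
    have hI : P.f^[n] (Int.fract x) ∈ I :=
      h.iterate_mem_I ⟨Int.fract_nonneg x, Int.fract_lt_one x⟩ n
    set z := P.f^[n] (Int.fract x)
    have e : z + ⌊x⌋ + P.visits n (Int.fract x)
        = z + ((⌊x⌋ + P.visits n (Int.fract x) : ℤ) : ℝ) := by
      push_cast; ring
    rw [e, Params.F, Int.fract_add_intCast, Int.floor_add_intCast, Int.fract_eq_self.2 hI,
      Int.floor_eq_zero_iff.2 hI]
    split_ifs with h1
    · rw [f_left h1]; push_cast; ring
    · rw [f_right (not_lt.1 h1)]; push_cast; ring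

lemma tendsto_F (h : P.Facts) (x : ℝ) :
    Tendsto (fun n : ℕ => P.F^[n] x / n) atTop (𝓝 h.rotNum) := by
  obtain ⟨M, hM⟩ := h.exists_entry
  set s := Int.fract x
  have hs : s ∈ I := ⟨Int.fract_nonneg x, Int.fract_lt_one x⟩
  refine tendsto_div_of_abs_sub_le (M := M)
    (C := 1 + |(⌊x⌋ : ℝ)| + (P.visits M s + 1 + M * |h.rotNum|)) fun n hn => ?_
  obtain ⟨k, rfl⟩ := Nat.exists_eq_add_of_le hn
  have h1 := h.abs_visits_sub_le (hM s hs) k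
  have h2 := h.iterate_mem_I hs (M + k)
  rw [h.F_iterate, P.visits_add]
  have h3 : |P.f^[M + k] s| ≤ 1 := by
    rw [abs_le]; exact ⟨by linarith [h2.1], h2.2.le⟩
  have e : P.f^[M + k] s + ⌊x⌋ + ((P.visits M s + P.visits k (P.f^[M] s) : ℕ) : ℝ)
      - ((M + k : ℕ) : ℝ) * h.rotNum
      = P.f^[M + k] s + ⌊x⌋ + (P.visits M s + (P.visits k (P.f^[M] s) - k * h.rotNum)
        + - (M * h.rotNum)) := by
    push_cast; ring
  rw [e]
  refine (abs_add_le _ _).trans (add_le_add ((abs_add_le _ _).trans (add_le_add h3 le_rfl)) ?_)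
  refine (abs_add_le _ _).trans (add_le_add ((abs_add_le _ _).trans (add_le_add ?_ h1)) ?_)
  · rw [Nat.abs_cast]
  · rw [abs_neg, abs_mul, Nat.abs_cast]

lemma isRotationNumber (h : P.Facts) : P.IsRotationNumber h.rotNum :=
  ⟨h.rotNum, h.tendsto_F, (Int.fract_eq_self.2 ⟨h.rotNum_mem.1.le, h.rotNum_mem.2⟩).symm⟩

lemma eq_rotNum (h : P.Facts) {rho : ℝ} (hr : P.IsRotationNumber rho) : rho = h.rotNum := by
  obtain ⟨L, hL, rfl⟩ := hr
  rw [tendsto_nhds_unique (hL 0) (h.tendsto_F 0)]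
  exact Int.fract_eq_self.2 ⟨h.rotNum_mem.1.le, h.rotNum_mem.2⟩

/-- The distance from the fixed point of the left branch is multiplied by at least
`lam * (mu + e)` on the right branch, for some `e > 0`. As it stays bounded, the geometric mean
`lam * (mu + e) ^ rho` of the factors is at most one. -/
lemma admissible (h : P.Facts) : Admissible P.lam P.mu h.rotNum := by
  have hl := h.lam_pos
  have hl1 := h.lam_lt
  have hm := h.mu_pos
  obtain ⟨hr0, hr1⟩ := h.rotNum_mem
  refine ⟨hl, hl1, hm, hr0, hr1, ?_⟩
  by_contra hcon
  set L := h.rotNum with hL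
  set K := P.a / (1 - P.lam) with hK
  have hK1 : K * (1 - P.lam) = P.a := div_mul_cancel₀ _ (by linarith)
  have hW : 0 < K - P.c := by linarith [h.kap, h.c_lt_b]
  -- the right branch sends `x` to distance `lam * mu * (K - x) + d` from `K`
  set d := K + P.lam * P.mu * (P.eta - K) - P.c with hd
  have hd0 : 0 < d := by
    have e : d * (1 - P.lam)
        = P.lam * P.c + P.a - (P.lam * P.mu * (P.b - P.eta) + P.c) := by
      have := h.a_eq
      rw [hd]
      linear_combination (1 - P.lam * P.mu) * hK1 - (P.lam * P.mu) * this
    have h1 : 0 < d * (1 - P.lam) := by rw [e]; linarith [h.gap]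
    exact pos_of_mul_pos_left h1 (by linarith)
  set e := d / (P.lam * (K - P.c)) with he
  have he0 : 0 < e := by positivity
  have hrec : ∀ n, P.lam ^ n * (P.mu + e) ^ P.visits n P.c * (K - P.c) ≤ K - P.f^[n] P.c := by
    intro n
    induction n with
    | zero => simp [Params.visits]
    | succ n ih =>
      have hJ := h.iterate_mem_J h.c_mem n
      rw [Function.iterate_succ_apply', Params.visits]
      set z := P.f^[n] P.c
      split_ifs with h1
      · rw [f_left h1, add_zero, pow_succ]
        nlinarith
      · rw [f_right (not_lt.1 h1), pow_succ, pow_succ]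
        have h2 : P.lam * (P.mu + e) * (K - z) ≤ P.lam * P.mu * (K - z) + d := by
          have : P.lam * e * (K - P.c) = d := by rw [he]; field_simp
          have : P.lam * e * (K - z) ≤ P.lam * e * (K - P.c) :=
            mul_le_mul_of_nonneg_left (by linarith [hJ.1]) (by positivity)
          nlinarith
        have h3 : P.lam * (P.mu + e) * (P.lam ^ n * (P.mu + e) ^ P.visits n P.c * (K - P.c))
            ≤ P.lam * (P.mu + e) * (K - z) := mul_le_mul_of_nonneg_left ih (by positivity)
        calc P.lam ^ n * P.lam * ((P.mu + e) ^ P.visits n P.c * (P.mu + e)) * (K - P.c)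
            = P.lam * (P.mu + e) * (P.lam ^ n * (P.mu + e) ^ P.visits n P.c * (K - P.c)) := by ring
          _ ≤ P.lam * P.mu * (K - z) + d := h3.trans h2
          _ = _ := by rw [hd]; ring
  have hbound : ∀ n : ℕ, n * Real.log P.lam + P.visits n P.c * Real.log (P.mu + e) ≤ 0 := by
    intro n
    have h1 : P.lam ^ n * (P.mu + e) ^ P.visits n P.c ≤ 1 := by
      have h2 : P.lam ^ n * (P.mu + e) ^ P.visits n P.c * (K - P.c) ≤ 1 * (K - P.c) := by
        linarith [hrec n, (h.iterate_mem_J h.c_mem n).1]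
      exact le_of_mul_le_mul_right h2 hW
    have h3 := Real.log_nonpos (by positivity) h1
    rwa [Real.log_mul (by positivity) (by positivity), Real.log_pow, Real.log_pow] at h3
  have hlog : 0 ≤ Real.log P.lam + L * Real.log P.mu := by
    have := Real.log_nonneg (not_lt.1 hcon)
    rwa [Real.log_mul hl.ne' (Real.rpow_pos_of_pos hm L).ne', Real.log_rpow hm] at this
  have hlm : 0 < Real.log P.mu := by
    have := Real.log_neg hl hl1
    by_contra h1
    nlinarith
  have hlt : Real.log P.mu < Real.log (P.mu + e) := Real.log_lt_log hm (by linarith)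
  have hδ : 0 < L * (Real.log (P.mu + e) - Real.log P.mu) := mul_pos hr0 (by linarith)
  obtain ⟨n, hn⟩ := exists_nat_gt
    (Real.log (P.mu + e) / (L * (Real.log (P.mu + e) - Real.log P.mu)))
  rw [div_lt_iff₀ hδ] at hn
  have h1 := (abs_le.1 (h.abs_visits_sub_le h.c_mem n)).1
  have h2 : (n * L - 1) * Real.log (P.mu + e) ≤ P.visits n P.c * Real.log (P.mu + e) :=
    mul_le_mul_of_nonneg_right (by linarith) (by linarith)
  have h3 : 0 ≤ (n : ℝ) * (Real.log P.lam + L * Real.log P.mu) := by positivity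
  have h4 := hbound n
  nlinarith

end Params.Facts

/-! ### The function `phi` and orbits that follow a rotation -/

variable {r : ℝ}

/-- The length of the gap between the images of the two branches. -/
noncomputable def Params.gapLen (P : Params) : ℝ :=
  P.lam * P.c + P.a - (P.lam * P.mu * (P.b - P.eta) + P.c)

section Phi

lemma Params.Facts.gapLen_eq (h : P.Facts) :
    (1 - P.lam) * (P.c - P.mu * P.b) + P.a * (P.mu - 1) = - P.gapLen := by
  have := h.a_eq
  rw [Params.gapLen]
  linear_combination P.mu * this

lemma Params.Facts.gapLen_pos (h : P.Facts) : 0 < P.gapLen := by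
  have := h.gap
  rw [Params.gapLen]; linarith

lemma Params.Facts.phi_eq (h : P.Facts) {y : ℝ} (hy : y ∈ I) :
    P.phi r y = P.a / (1 - P.lam) - P.gapLen / P.lam * Phi r P.lam P.mu (-y) := by
  rw [Params.phi, Int.floor_eq_zero_iff.2 hy, Int.fract_eq_self.2 hy, h.gapLen_eq]
  push_cast; ring

/-- On `[0, 1 - r)`, `phi` intertwines the rotation with the left affine branch, whether or not its
values lie to the left of the break point. -/
lemma Params.Facts.phi_left (h : P.Facts) (ha : Admissible P.lam P.mu r) {y : ℝ} (hy : 0 ≤ y)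
    (hy1 : y < 1 - r) : P.phi r (y + r) = P.lam * P.phi r y + P.a := by
  have hl := h.lam_pos
  have hl1 : 1 - P.lam ≠ 0 := by linarith [h.lam_lt]
  have hr := ha.r_pos
  rw [h.phi_eq ⟨by linarith, by linarith⟩, h.phi_eq ⟨hy, by linarith⟩, ha.Phi_rot_left hy]
  field_simp
  ring

/-- On `[1 - r, 1)`, `phi` intertwines the rotation with the right affine branch. -/
lemma Params.Facts.phi_right (h : P.Facts) (ha : Admissible P.lam P.mu r) {y : ℝ}
    (hy : 1 - r ≤ y) (hy1 : y < 1) :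
    P.phi r (y + r - 1) = P.lam * P.mu * (P.phi r y - P.eta) + P.c := by
  have hl := h.lam_pos
  have hl1 : 1 - P.lam ≠ 0 := by linarith [h.lam_lt]
  have hr := ha.r_pos
  have hr1 := ha.r_lt
  rw [h.phi_eq ⟨by linarith, by linarith⟩, h.phi_eq ⟨by linarith, hy1⟩, ha.Phi_rot_right hy hy1]
  have e := h.a_eq
  rw [Params.gapLen]
  field_simp
  linear_combination -(P.mu * P.lam) * e

lemma Params.Facts.phi_mono (h : P.Facts) (ha : Admissible P.lam P.mu r) {y y' : ℝ} (hy : y ∈ I)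
    (hy' : y' ∈ I) (hyy : y ≤ y') : P.phi r y ≤ P.phi r y' := by
  rw [h.phi_eq hy, h.phi_eq hy']
  have := ha.Phi_antitone hy.1 hyy
  have := mul_le_mul_of_nonneg_left this (div_pos h.gapLen_pos h.lam_pos).le
  linarith

lemma Params.Facts.phi_jump (h : P.Facts) (ha : Admissible P.lam P.mu r) {y y' : ℝ} (hy : y ∈ I)
    (hy' : y' ∈ I) {k l : ℕ} (h1 : y < k * r - l) (h2 : k * r - l ≤ y') :
    P.phi r y + P.gapLen / P.lam * (P.lam ^ k * P.mu ^ l) ≤ P.phi r y' := by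
  rw [h.phi_eq hy, h.phi_eq hy']
  have := ha.Phi_jump hy.1 h1 h2
  have := mul_le_mul_of_nonneg_left this (div_pos h.gapLen_pos h.lam_pos).le
  linarith

lemma Params.Facts.jump_pos (h : P.Facts) (k l : ℕ) :
    0 < P.gapLen / P.lam * (P.lam ^ k * P.mu ^ l) := by
  have := h.gapLen_pos; have := h.lam_pos; have := h.mu_pos
  positivity

lemma Params.Facts.phi_right_continuous (h : P.Facts) (ha : Admissible P.lam P.mu r) {y : ℝ}
    (hy : y ∈ I) : Tendsto (P.phi r) (𝓝[>] y) (𝓝 (P.phi r y)) := by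
  rw [h.phi_eq hy]
  refine ((((ha.Phi_right_continuous hy.1).const_mul _).const_sub _)).congr' ?_
  filter_upwards [self_mem_nhdsWithin, nhdsWithin_le_nhds (Iio_mem_nhds hy.2)] with z h1 h2
  exact (h.phi_eq ⟨hy.1.trans (le_of_lt h1), h2⟩).symm

lemma fract_mem (y : ℝ) : Int.fract y ∈ I := ⟨Int.fract_nonneg y, Int.fract_lt_one y⟩

lemma zero_mem_I : (0 : ℝ) ∈ I := ⟨le_rfl, one_pos⟩

lemma Params.Facts.phi_bounds (h : P.Facts) (ha : Admissible P.lam P.mu r) {y : ℝ} (hy : y ∈ I) :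
    P.phi r 0 ≤ P.phi r y ∧ P.phi r y ≤ P.a / (1 - P.lam) := by
  refine ⟨h.phi_mono ha zero_mem_I hy hy.1, ?_⟩
  rw [h.phi_eq hy]
  have h1 : 0 ≤ Phi r P.lam P.mu (-y) := tsum_nonneg fun k => geo_nonneg h.lam_pos h.mu_pos _ _
  have := mul_nonneg (div_pos h.gapLen_pos h.lam_pos).le h1
  linarith

lemma fract_rot_left (hr : 0 < r) {y : ℝ} (hy : Int.fract y < 1 - r) :
    Int.fract (y + r) = Int.fract y + r ∧ ⌊y + r⌋ = ⌊y⌋ := by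
  have h1 := Int.fract_add_floor y
  have h0 := Int.fract_nonneg y
  have h2 : ⌊y + r⌋ = ⌊y⌋ := by rw [Int.floor_eq_iff]; constructor <;> linarith
  exact ⟨by rw [Int.fract, h2]; linarith, h2⟩

lemma fract_rot_right (hr : r < 1) {y : ℝ} (hy : 1 - r ≤ Int.fract y) :
    Int.fract (y + r) = Int.fract y + r - 1 ∧ ⌊y + r⌋ = ⌊y⌋ + 1 := by
  have h1 := Int.fract_add_floor y
  have h0 := Int.fract_lt_one y
  have h2 : ⌊y + r⌋ = ⌊y⌋ + 1 := by
    rw [Int.floor_eq_iff]; push_cast; constructor <;> linarith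
  exact ⟨by rw [Int.fract, h2]; push_cast; linarith, h2⟩

end Phi

/-- The first `n` steps of the orbit of `x` follow the two branches in the order in which the
rotation by `r` of the point `y` of the circle enters `[0, 1 - r)` and `[1 - r, 1)`. -/
def Params.Follows (P : Params) (r x y : ℝ) (n : ℕ) : Prop :=
  ∀ m ≤ n, (P.visits m x : ℤ) = ⌊y + m * r⌋ - ⌊y⌋

namespace Params.Facts

lemma follows_branch (ha : Admissible P.lam P.mu r) {x y : ℝ} {n : ℕ}
    (hf : P.Follows r x y (n + 1)) : P.f^[n] x < P.eta ↔ Int.fract (y + n * r) < 1 - r := by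
  have h1 := hf n (by omega)
  have h2 := hf (n + 1) le_rfl
  have e : y + ((n + 1 : ℕ) : ℝ) * r = (y + n * r) + r := by push_cast; ring
  rw [e, Params.visits] at h2
  rcases lt_or_ge (Int.fract (y + n * r)) (1 - r) with h3 | h3
  · rw [(fract_rot_left ha.r_pos h3).2] at h2
    refine ⟨fun _ => h3, fun _ => ?_⟩
    by_contra h4
    rw [if_neg h4] at h2
    push_cast at h2
    omega
  · rw [(fract_rot_right ha.r_lt h3).2] at h2
    refine ⟨fun h4 => ?_, fun h4 => absurd h3 (not_le.2 h4)⟩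
    rw [if_pos h4] at h2
    push_cast at h2
    omega

/-- Two points whose orbits take the same branches are moved by the same affine maps. -/
lemma follows_sub (h : P.Facts) (ha : Admissible P.lam P.mu r) {x y : ℝ} {n : ℕ}
    (hf : P.Follows r x y n) : P.f^[n] x - P.phi r (Int.fract (y + n * r))
      = P.lam ^ n * P.mu ^ P.visits n x * (x - P.phi r (Int.fract y)) := by
  induction n with
  | zero => simp [Params.visits]
  | succ n ih =>
    have hb := follows_branch ha hf
    have ih' := ih fun m hm => hf m (by omega)
    have e : y + ((n + 1 : ℕ) : ℝ) * r = (y + n * r) + r := by push_cast; ring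
    rw [Function.iterate_succ_apply', Params.visits, e]
    set z := P.f^[n] x
    set w := y + n * r
    rcases lt_or_ge (Int.fract w) (1 - r) with h1 | h1
    · rw [if_pos (hb.2 h1), f_left (hb.2 h1), (fract_rot_left ha.r_pos h1).1,
        h.phi_left ha (Int.fract_nonneg _) h1, add_zero, pow_succ]
      linear_combination P.lam * ih'
    · have h2 : P.eta ≤ z := not_lt.1 fun h3 => not_le.2 (hb.1 h3) h1
      rw [if_neg (not_lt.2 h2), f_right h2, (fract_rot_right ha.r_lt h1).1,
        h.phi_right ha h1 (Int.fract_lt_one _), pow_succ, pow_succ]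
      linear_combination P.lam * P.mu * ih'

/-- The orbit of every point of `[c, b)` eventually follows an orbit of the rotation. -/
lemma exists_follows (h : P.Facts) {x : ℝ} (hx : x ∈ P.J) :
    ∃ N : ℕ, ∃ y : ℝ, (∀ n, P.Follows h.rotNum (P.f^[N] x) y n) ∧
      ∀ q p : ℕ, (q : ℝ) * h.rotNum = p → ∃ z : ℤ, q * y = z := by
  have hfl : ∀ n, ⌊P.pos n x⌋ = (P.visits n x : ℤ) := fun n => by
    rw [Int.floor_eq_iff]; exact_mod_cast h.pos_mem hx n
  have hclose : ∀ m n : ℕ, |(((P.visits m x : ℤ) : ℝ) - m * h.rotNum)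
      - ((P.visits n x : ℤ) - n * h.rotNum)| ≤ 1 := by
    have key : ∀ m n : ℕ, m ≤ n → |(((P.visits n x : ℤ) : ℝ) - n * h.rotNum)
        - ((P.visits m x : ℤ) - m * h.rotNum)| ≤ 1 := by
      intro m n hmn
      obtain ⟨k, rfl⟩ := Nat.exists_eq_add_of_le hmn
      refine le_trans (le_of_eq ?_) (h.abs_visits_sub_le (h.iterate_mem_J hx m) k)
      rw [P.visits_add]
      push_cast
      ring_nf
    intro m n
    rcases le_total n m with hmn | hmn
    · exact key n m hmn
    · rw [abs_sub_comm]; exact key m n hmn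
  have hsign : ∀ (q : ℕ) (p : ℤ), (q : ℝ) * h.rotNum = p →
      (∃ n₀, ∀ n, n₀ ≤ n → (P.visits n x : ℤ) + p ≤ (P.visits (n + q) x : ℤ)) ∨
        ∃ n₀, ∀ n, n₀ ≤ n → ((P.visits (n + q) x : ℤ) : ℤ) ≤ (P.visits n x : ℤ) + p := by
    intro q p _
    rcases le_total (P.pos 0 x + p) (P.pos q x) with h0 | h0
    · have h1 : ∀ n, P.pos n x + p ≤ P.pos (n + q) x := by
        intro n
        induction n with
        | zero => simpa using h0
        | succ n ih =>
          have := h.lift.monotone ih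
          rwa [h.lift.map_add_int, h.lift_pos hx, h.lift_pos hx, add_right_comm] at this
      exact Or.inl ⟨0, fun n _ => by
        have := Int.floor_mono (h1 n)
        rwa [Int.floor_add_intCast, hfl, hfl] at this⟩
    · have h1 : ∀ n, P.pos (n + q) x ≤ P.pos n x + p := by
        intro n
        induction n with
        | zero => simpa using h0
        | succ n ih =>
          have := h.lift.monotone ih
          rwa [h.lift.map_add_int, h.lift_pos hx, h.lift_pos hx, add_right_comm] at this
      exact Or.inr ⟨0, fun n _ => by
        have := Int.floor_mono (h1 n)
        rwa [Int.floor_add_intCast, hfl, hfl] at this⟩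
  obtain ⟨y, N, h1, h2⟩ := exists_floor_line (S := fun n => (P.visits n x : ℤ))
    (θ := h.rotNum) hclose hsign
  refine ⟨N, y + N * h.rotNum, fun n m _ => ?_, fun q p hq => ?_⟩
  · have e1 := h1 (N + m) (by omega)
    have e2 := h1 N le_rfl
    rw [P.visits_add] at e1
    push_cast at e1
    rw [e2, show y + N * h.rotNum + m * h.rotNum = y + (N + m) * h.rotNum by ring, e1]
    ring
  · obtain ⟨z, hz⟩ := h2 q p (by exact_mod_cast hq)
    refine ⟨z + N * p, ?_⟩
    push_cast
    rw [← hz, ← hq]; ring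

lemma visits_le (h : P.Facts) {x : ℝ} (hx : x ∈ P.J) (n : ℕ) :
    (P.visits n x : ℝ) ≤ n * h.rotNum + 1 := by
  linarith [(abs_le.1 (h.abs_visits_sub_le hx n)).2]

/-- Every orbit of `I` is asymptotic to the image under `phi` of an orbit of the rotation, and
eventually takes the same branches. -/
lemma exists_asymptotic (h : P.Facts) {x : ℝ} (hx : x ∈ I) :
    ∃ N : ℕ, ∃ y : ℝ,
      (∀ n : ℕ, P.f^[N + n] x < P.eta ↔ Int.fract (y + n * h.rotNum) < 1 - h.rotNum) ∧
      Tendsto (fun n : ℕ => P.f^[N + n] x - P.phi h.rotNum (Int.fract (y + n * h.rotNum)))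
        atTop (𝓝 0) ∧
      ∀ q p : ℕ, (q : ℝ) * h.rotNum = p → ∃ z : ℤ, q * y = z := by
  obtain ⟨M, hM⟩ := h.exists_entry
  have hJ := hM x hx
  obtain ⟨N, y, h1, h2⟩ := h.exists_follows hJ
  have e : ∀ n, P.f^[(M + N) + n] x = P.f^[n] (P.f^[N] (P.f^[M] x)) := fun n => by
    rw [add_comm (M + N), add_comm M, Function.iterate_add_apply, Function.iterate_add_apply]
  refine ⟨M + N, y, fun n => ?_, ?_, h2⟩
  · rw [e]; exact follows_branch h.admissible (h1 (n + 1))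
  · have h3 := (h.admissible.tendsto_slope (h.visits_le (h.iterate_mem_J hJ N))).mul_const
      (P.f^[N] (P.f^[M] x) - P.phi h.rotNum (Int.fract y))
    rw [zero_mul] at h3
    refine h3.congr fun n => ?_
    rw [e]
    exact (h.follows_sub h.admissible (h1 n)).symm

/-- A backward orbit in `[c, b)` is, from some time on, the image under `phi` of a backward orbit of
the rotation. -/
lemma exists_backward (h : P.Facts) {X : ℕ → ℝ} (hX : ∀ n, X n ∈ P.J)
    (hfX : ∀ n, P.f (X (n + 1)) = X n) :
    ∃ N : ℕ, ∃ y : ℝ, (∀ n, N ≤ n → X n = P.phi h.rotNum (Int.fract (y - n * h.rotNum))) ∧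
      ∀ q p : ℕ, (q : ℝ) * h.rotNum = p → ∃ z : ℤ, q * y = z := by
  have hit : ∀ m n, P.f^[m] (X (n + m)) = X n := by
    intro m
    induction m with
    | zero => simp
    | succ m ih => intro n; rw [← add_assoc, Function.iterate_succ_apply, hfX, ih]
  have hvis : ∀ m n, P.visits (n + m) (X (n + m)) = P.visits m (X (n + m)) + P.visits n (X n) := by
    intro m n
    nth_rw 1 [add_comm n m]
    rw [P.visits_add, hit]
  -- the lifted backward orbit
  set T : ℕ → ℝ := fun n => (X n - P.c) / (P.b - P.c) + ((-(P.visits n (X n) : ℤ) : ℤ) : ℝ) with hT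
  have hfl : ∀ n, ⌊T n⌋ = -(P.visits n (X n) : ℤ) := fun n => by
    rw [hT]
    simp only [Int.floor_add_intCast, Int.floor_eq_zero_iff.2 (h.coord_mem (hX n)), zero_add]
  have hlift : ∀ n, h.lift (T (n + 1)) = T n := by
    intro n
    have h1 : P.visits (n + 1) (X (n + 1))
        = (if X (n + 1) < P.eta then 0 else 1) + P.visits n (X n) := by
      rw [hvis 1 n]
      by_cases hx : X (n + 1) < P.eta <;> simp [Params.visits, hx]
    simp only [hT]
    rw [h.lift_coord (hX _), h1, Params.step, hfX]
    split_ifs <;> push_cast <;> ring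
  clear_value T
  have hclose : ∀ m n : ℕ, |(((-(P.visits m (X m) : ℤ) : ℤ) : ℝ) - m * -h.rotNum)
      - ((-(P.visits n (X n) : ℤ) : ℤ) - n * -h.rotNum)| ≤ 1 := by
    have key : ∀ m n : ℕ, m ≤ n → |(((-(P.visits m (X m) : ℤ) : ℤ) : ℝ) - m * -h.rotNum)
        - (((-(P.visits n (X n) : ℤ) : ℤ) : ℝ) - n * -h.rotNum)| ≤ 1 := by
      intro m n hmn
      obtain ⟨k, rfl⟩ := Nat.exists_eq_add_of_le hmn
      refine le_trans (le_of_eq ?_) (h.abs_visits_sub_le (hX (m + k)) k)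
      rw [hvis]
      push_cast
      ring_nf
    intro m n
    rcases le_total m n with hmn | hmn
    · exact key m n hmn
    · rw [abs_sub_comm]; exact key n m hmn
  have hsign : ∀ (q : ℕ) (p : ℤ), (q : ℝ) * -h.rotNum = p →
      (∃ n₀, ∀ n, n₀ ≤ n →
          (-(P.visits n (X n) : ℤ) : ℤ) + p ≤ -(P.visits (n + q) (X (n + q)) : ℤ)) ∨
        ∃ n₀, ∀ n, n₀ ≤ n →
          (-(P.visits (n + q) (X (n + q)) : ℤ) : ℤ) ≤ -(P.visits n (X n) : ℤ) + p := by
    intro q p _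
    have hpow : ∀ m n, (h.lift ^ m) (T (n + m)) = T n := by
      intro m
      induction m with
      | zero => simp
      | succ m ih => intro n; rw [pow_succ, CircleDeg1Lift.mul_apply, ← add_assoc, hlift, ih]
    by_cases hex : ∃ n₀, T (n₀ + q) < T n₀ + p
    · obtain ⟨n₀, hn₀⟩ := hex
      refine Or.inr ⟨n₀, fun n hn => ?_⟩
      have h1 : T (n + q) ≤ T n + p := by
        obtain ⟨k, rfl⟩ := Nat.exists_eq_add_of_le hn
        by_contra hcon
        have := (h.lift ^ k).monotone (not_le.1 hcon).le
        rw [(h.lift ^ k).map_add_int, hpow, add_right_comm, hpow] at this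
        linarith
      have := Int.floor_mono h1
      rwa [Int.floor_add_intCast, hfl, hfl] at this
    · refine Or.inl ⟨0, fun n _ => ?_⟩
      have h1 : T n + p ≤ T (n + q) := not_lt.1 fun h3 => hex ⟨n, h3⟩
      have := Int.floor_mono h1
      rwa [Int.floor_add_intCast, hfl, hfl] at this
  obtain ⟨y, N, h1, h2⟩ := exists_floor_line (S := fun n => -(P.visits n (X n) : ℤ))
    (θ := -h.rotNum) hclose hsign
  have hfol : ∀ n i, N ≤ n → P.Follows h.rotNum (X (n + i)) (y - (n + i : ℕ) * h.rotNum) i := by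
    intro n i hn m hm
    obtain ⟨k, rfl⟩ := Nat.exists_eq_add_of_le hm
    have e1 := h1 (n + k + m) (by omega)
    have e2 := h1 (n + k) (by omega)
    have e3 := hvis m (n + k)
    rw [show n + (m + k) = n + k + m by ring]
    rw [mul_neg, ← sub_eq_add_neg] at e1 e2
    rw [e1, show y - ((n + k + m : ℕ) : ℝ) * h.rotNum + m * h.rotNum
      = y - ((n + k : ℕ) : ℝ) * h.rotNum by push_cast; ring, e2, e3]
    push_cast; ring
  refine ⟨N, y, fun n hn => ?_, fun q p hq => ?_⟩
  · set B := P.a / (1 - P.lam) - P.phi h.rotNum 0 + (P.a / (1 - P.lam) - P.c) with hB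
    have hkap := h.kap
    have hbd : ∀ i, |X n - P.phi h.rotNum (Int.fract (y - n * h.rotNum))|
        ≤ P.lam ^ i * P.mu ^ P.visits i (X (n + i)) * B := by
      intro i
      have h3 := h.follows_sub h.admissible (hfol n i hn)
      rw [hit, show y - ((n + i : ℕ) : ℝ) * h.rotNum + i * h.rotNum
        = y - n * h.rotNum by push_cast; ring] at h3
      have hpos : 0 < P.lam ^ i * P.mu ^ P.visits i (X (n + i)) := by
        have := h.lam_pos; have := h.mu_pos; positivity
      rw [h3, abs_mul, abs_of_pos hpos]
      refine mul_le_mul_of_nonneg_left ?_ hpos.le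
      obtain ⟨b1, b2⟩ := h.phi_bounds h.admissible
        (fract_mem (y - ((n + i : ℕ) : ℝ) * h.rotNum))
      obtain ⟨b3, b4⟩ := hX (n + i)
      rw [abs_le]
      constructor <;> linarith
    have hlim := (h.admissible.tendsto_slope (S := fun i => P.visits i (X (n + i)))
      fun i => h.visits_le (hX _) i).mul_const B
    rw [zero_mul] at hlim
    have := ge_of_tendsto' hlim hbd
    have := abs_nonpos_iff.1 this
    linarith
  · exact (h2 q (-p) (by push_cast; linarith))

end Params.Facts

/-! ### Limit sets, and irrational rotation numbers -/

section LimitSets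

lemma mem_omegaSet {f : ℝ → ℝ} {x z : ℝ} :
    z ∈ omegaSet f x ↔ ∀ N : ℕ, ∀ ε > 0, ∃ n, N ≤ n ∧ |f^[n] x - z| < ε := by
  simp only [omegaSet, mem_iInter, Metric.mem_closure_iff]
  refine forall_congr' fun N => forall₂_congr fun ε _ => ⟨?_, ?_⟩
  · rintro ⟨_, ⟨k, hk, rfl⟩, h⟩
    exact ⟨k, hk, by rwa [abs_sub_comm, ← Real.dist_eq]⟩
  · rintro ⟨k, hk, h⟩
    exact ⟨_, ⟨k, hk, rfl⟩, by rwa [abs_sub_comm, ← Real.dist_eq] at h⟩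

/-- The `ω`-limit set of an orbit can be read off from any sequence asymptotic to it. -/
lemma mem_omegaSet_of_asymptotic {f : ℝ → ℝ} {x z : ℝ} {N : ℕ} {g : ℕ → ℝ}
    (hg : Tendsto (fun n => f^[N + n] x - g n) atTop (𝓝 0)) :
    z ∈ omegaSet f x ↔ ∀ M : ℕ, ∀ ε > 0, ∃ n, M ≤ n ∧ |g n - z| < ε := by
  rw [mem_omegaSet]
  have hsmall : ∀ ε > 0, ∃ K, ∀ n, K ≤ n → |f^[N + n] x - g n| < ε := fun ε hε => by
    obtain ⟨K, hK⟩ := Metric.tendsto_atTop.1 hg ε hε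
    exact ⟨K, fun n hn => by simpa [Real.dist_eq] using hK n hn⟩
  constructor
  · intro h M ε hε
    obtain ⟨K, hK⟩ := hsmall (ε / 2) (by linarith)
    obtain ⟨n, hn, hz⟩ := h (N + max M K) (ε / 2) (by linarith)
    obtain ⟨j, rfl⟩ := Nat.exists_eq_add_of_le ((Nat.le_add_right N _).trans hn)
    have hj : max M K ≤ j := by omega
    refine ⟨j, (le_max_left _ _).trans hj, ?_⟩
    have h1 := abs_lt.1 (hK j ((le_max_right _ _).trans hj))
    have h2 := abs_lt.1 hz
    rw [abs_lt]; constructor <;> linarith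
  · intro h M ε hε
    obtain ⟨K, hK⟩ := hsmall (ε / 2) (by linarith)
    obtain ⟨n, hn, hz⟩ := h (max M K) (ε / 2) (by linarith)
    refine ⟨N + n, ?_, ?_⟩
    · have := (le_max_left _ _).trans hn; omega
    · have h1 := abs_lt.1 (hK n ((le_max_right _ _).trans hn))
      have h2 := abs_lt.1 hz
      rw [abs_lt]; constructor <;> linarith

/-- Points of the limit set have backward orbits in `[c, b)`. -/
lemma Params.Facts.exists_backward_orbit (h : P.Facts) {x : ℝ} (hx : x ∈ limitSet P.f) :
    ∃ X : ℕ → ℝ, X 0 = x ∧ (∀ n, X n ∈ P.J) ∧ ∀ n, P.f (X (n + 1)) = X n := by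
  obtain ⟨M, hM⟩ := h.exists_entry
  have h1 : ∀ n, ∃ z ∈ P.J, P.f^[n] z = x := by
    intro n
    obtain ⟨w, hw, hwx⟩ := mem_iInter.1 hx (n + M)
    exact ⟨P.f^[M] w, hM w hw, by rwa [← Function.iterate_add_apply]⟩
  choose X hXJ hX using h1
  refine ⟨X, hX 0, hXJ, fun n => ?_⟩
  refine h.injOn_J.iterate h.mapsTo_J n (h.mapsTo_J (hXJ _)) (hXJ n) ?_
  rw [← Function.iterate_succ_apply, hX, hX]

/-- If `phi` carries the rotation of an invariant set `Y` to `f`, then iterates correspond. -/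
lemma Params.iterate_phi {Y : Set ℝ} (hY : Y ⊆ I)
    (hrot : ∀ y, Int.fract y ∈ Y → ∀ n : ℤ, Int.fract (y + n * r) ∈ Y)
    (hconj : ∀ y ∈ Y, P.f (P.phi r y) = P.phi r (rot r y)) {y : ℝ} (hy : y ∈ Y) (n : ℕ) :
    P.f^[n] (P.phi r y) = P.phi r (Int.fract (y + n * r)) := by
  have hy' : Int.fract y = y := Int.fract_eq_self.2 (hY hy)
  induction n with
  | zero => simp [hy']
  | succ n ih =>
    have h1 := hrot y (by rwa [hy']) n
    rw [Int.cast_natCast] at h1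
    rw [Function.iterate_succ_apply', ih, hconj _ h1, rot]
    congr 1
    rw [Int.fract_eq_fract]
    refine ⟨-⌊y + n * r⌋, ?_⟩
    rw [Int.fract]; push_cast; ring

/-- If `phi` conjugates the rotation on an invariant set `Y` of angles to `f`, and `Y` contains all
angles that can arise from backward orbits, then the limit set is the image of `Y`. -/
lemma Params.Facts.limitSet_eq (h : P.Facts) {Y : Set ℝ} (hY : Y ⊆ I)
    (hrot : ∀ y, Int.fract y ∈ Y → ∀ n : ℤ, Int.fract (y + n * h.rotNum) ∈ Y)
    (hconj : ∀ y ∈ Y, P.f (P.phi h.rotNum y) = P.phi h.rotNum (rot h.rotNum y))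
    (hJ : MapsTo (P.phi h.rotNum) Y P.J)
    (hback : ∀ y : ℝ, (∀ q p : ℕ, (q : ℝ) * h.rotNum = p → ∃ z : ℤ, q * y = z) → Int.fract y ∈ Y) :
    limitSet P.f = P.phi h.rotNum '' Y := by
  apply Subset.antisymm
  · intro x hx
    obtain ⟨X, hX0, hXJ, hfX⟩ := h.exists_backward_orbit hx
    obtain ⟨N, y, h1, h2⟩ := h.exists_backward hXJ hfX
    have hit : ∀ m, P.f^[m] (X m) = x := by
      intro m
      induction m with
      | zero => simpa using hX0
      | succ m ih => rw [Function.iterate_succ_apply, hfX, ih]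
    have hy : Int.fract (y - N * h.rotNum) ∈ Y := by
      have := hrot y (hback y h2) (-N)
      rwa [Int.cast_neg, neg_mul, ← sub_eq_add_neg, Int.cast_natCast] at this
    have h3 := Params.iterate_phi hY hrot hconj hy N
    rw [← h1 N le_rfl, hit] at h3
    rw [h3]
    refine mem_image_of_mem _ ?_
    have := hrot (Int.fract (y - N * h.rotNum)) (by rwa [Int.fract_fract]) N
    rwa [Int.cast_natCast] at this
  · rintro _ ⟨y, hy, rfl⟩
    have hy' : Int.fract y = y := Int.fract_eq_self.2 (hY hy)
    refine mem_iInter.2 fun n => ?_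
    have h1 := hrot y (by rwa [hy']) (-n)
    refine ⟨_, h.J_subset (hJ h1), ?_⟩
    rw [Params.iterate_phi hY hrot hconj h1]
    congr 1
    conv_rhs => rw [← hy']
    rw [Int.fract_eq_fract]
    refine ⟨-⌊y + ((-n : ℤ) : ℝ) * h.rotNum⌋, ?_⟩
    rw [Int.fract]; push_cast; ring

lemma rot_mem {Y : Set ℝ} (hY : Y ⊆ I)
    (hrot : ∀ y, Int.fract y ∈ Y → ∀ n : ℤ, Int.fract (y + n * r) ∈ Y) : MapsTo (rot r) Y Y := by
  intro y hy
  have := hrot y (by rwa [Int.fract_eq_self.2 (hY hy)]) 1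
  rwa [Int.cast_one, one_mul] at this

/-- The conjugacy equation holds at an angle where `phi` lies on the correct side of the break
point. -/
lemma Params.Facts.f_phi (h : P.Facts) (ha : Admissible P.lam P.mu r) {y : ℝ} (hy : y ∈ I)
    (h1 : y < 1 - r → P.phi r y < P.eta) (h2 : 1 - r ≤ y → P.eta ≤ P.phi r y) :
    P.f (P.phi r y) = P.phi r (rot r y) := by
  have hy' : Int.fract y = y := Int.fract_eq_self.2 hy
  rw [rot]
  rcases lt_or_ge y (1 - r) with h3 | h3
  · rw [(fract_rot_left ha.r_pos (by rwa [hy'])).1, hy', f_left (h1 h3), h.phi_left ha hy.1 h3]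
  · rw [(fract_rot_right ha.r_lt (by rwa [hy'])).1, hy', f_right (h2 h3), h.phi_right ha h3 hy.2]

end LimitSets

namespace Params.Facts

section Irrational

/-- The jumps of `phi` are located at the angles `n rho` modulo one, which are dense. -/
lemma phi_strictMono (h : P.Facts) (hirr : Irrational h.rotNum) :
    StrictMonoOn (P.phi h.rotNum) I := by
  intro y hy y' hy' hyy
  obtain ⟨n, -, hn⟩ := fract_add_nat_mul_mem_Ioo hirr 0 hy.1 hyy hy'.2.le 0
  rw [zero_add] at hn
  have hr := h.rotNum_mem.1
  have hfl : ((⌊(n : ℝ) * h.rotNum⌋₊ : ℕ) : ℝ) = ⌊(n : ℝ) * h.rotNum⌋ :=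
    natCast_floor_eq_intCast_floor (by positivity)
  have h1 := Int.fract_add_floor ((n : ℝ) * h.rotNum)
  have h2 := h.phi_jump h.admissible hy hy' (k := n) (l := ⌊(n : ℝ) * h.rotNum⌋₊)
    (by rw [hfl]; linarith [hn.1]) (by rw [hfl]; linarith [hn.2])
  linarith [h.jump_pos n ⌊(n : ℝ) * h.rotNum⌋₊]

/-- Comparison with the orbit of `c`, whose itinerary is that of a rotation, places `phi` on the
correct side of the break point. -/
lemma eta_le_phi (h : P.Facts) (hirr : Irrational h.rotNum) {y : ℝ} (hy : y ∈ I)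
    (hy1 : 1 - h.rotNum ≤ y) : P.eta ≤ P.phi h.rotNum y := by
  obtain ⟨N, y₀, hbr, hlim, -⟩ := h.exists_asymptotic (h.J_subset h.c_mem)
  have key : ∀ y', y < y' → y' < 1 → P.eta ≤ P.phi h.rotNum y' := by
    intro y' h1 h2
    refine le_of_forall_pos_le_add fun ε hε => ?_
    obtain ⟨K, hK⟩ := Metric.tendsto_atTop.1 hlim ε hε
    obtain ⟨n, hn, hmem⟩ := fract_add_nat_mul_mem_Ioo hirr y₀ hy.1 h1 h2.le K
    have h3 := hK n hn
    rw [Real.dist_eq, sub_zero] at h3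
    have h4 := (abs_lt.1 h3).2
    have h5 := mt (hbr n).1 (not_lt.2 (hy1.trans hmem.1.le))
    have h6 := h.phi_mono h.admissible (fract_mem _) ⟨hy.1.trans h1.le, h2⟩ hmem.2.le
    linarith [not_lt.1 h5]
  refine ge_of_tendsto (h.phi_right_continuous h.admissible hy) ?_
  filter_upwards [self_mem_nhdsWithin, nhdsWithin_le_nhds (Iio_mem_nhds hy.2)] with y' h1 h2
  exact key y' h1 h2

lemma phi_lt_eta (h : P.Facts) (hirr : Irrational h.rotNum) {y : ℝ} (hy : y ∈ I)
    (hy1 : y < 1 - h.rotNum) : P.phi h.rotNum y < P.eta := by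
  obtain ⟨N, y₀, hbr, hlim, -⟩ := h.exists_asymptotic (h.J_subset h.c_mem)
  obtain ⟨hr0, hr1⟩ := h.rotNum_mem
  obtain ⟨y', h1, h2⟩ := exists_between hy1
  have hy' : y' ∈ I := ⟨hy.1.trans h1.le, by linarith⟩
  refine (h.phi_strictMono hirr hy hy' h1).trans_le ?_
  refine le_of_forall_pos_le_add fun ε hε => ?_
  obtain ⟨K, hK⟩ := Metric.tendsto_atTop.1 hlim ε hε
  obtain ⟨n, hn, hmem⟩ := fract_add_nat_mul_mem_Ioo hirr y₀ hy'.1 h2 (by linarith) K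
  have h3 := hK n hn
  rw [Real.dist_eq, sub_zero] at h3
  have h4 := (abs_lt.1 h3).1
  have h5 := (hbr n).2 hmem.2
  have h6 := h.phi_mono h.admissible hy' (fract_mem _) hmem.1.le
  linarith

lemma f_phi_irrational (h : P.Facts) (hirr : Irrational h.rotNum) :
    ∀ y ∈ I, P.f (P.phi h.rotNum y) = P.phi h.rotNum (rot h.rotNum y) := fun _ hy =>
  h.f_phi h.admissible hy (h.phi_lt_eta hirr hy) (h.eta_le_phi hirr hy)

lemma phi_mem_J_irrational (h : P.Facts) (hirr : Irrational h.rotNum) :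
    MapsTo (P.phi h.rotNum) I P.J := by
  obtain ⟨hr0, hr1⟩ := h.rotNum_mem
  intro y hy
  constructor
  · have h1 := h.eta_le_phi hirr (y := 1 - h.rotNum) ⟨by linarith, by linarith⟩ le_rfl
    have h2 := h.phi_right h.admissible (y := 1 - h.rotNum) le_rfl (by linarith)
    rw [show 1 - h.rotNum + h.rotNum - 1 = 0 by ring] at h2
    have h3 := mul_nonneg h.slope_pos.le (sub_nonneg.2 h1)
    linarith [(h.phi_bounds h.admissible hy).1]
  · set m := max y h.rotNum with hm
    have hmI : m ∈ I := ⟨hy.1.trans (le_max_left _ _), max_lt hy.2 hr1⟩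
    have hmr : h.rotNum ≤ m := le_max_right _ _
    have h1 := h.phi_mono h.admissible hy hmI (le_max_left _ _)
    have h2 := h.phi_left h.admissible (y := m - h.rotNum) (by linarith) (by linarith [hmI.2])
    rw [sub_add_cancel] at h2
    have h3 := h.f_left_lt (h.phi_lt_eta hirr (y := m - h.rotNum)
      ⟨by linarith, by linarith [hmI.2]⟩ (by linarith [hmI.2]))
    linarith

lemma limitSet_irrational (h : P.Facts) (hirr : Irrational h.rotNum) :
    limitSet P.f = P.phi h.rotNum '' I :=
  h.limitSet_eq subset_rfl (fun _ _ _ => fract_mem _) (h.f_phi_irrational hirr)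
    (h.phi_mem_J_irrational hirr) fun _ _ => fract_mem _

lemma omegaSet_irrational (h : P.Facts) (hirr : Irrational h.rotNum) {x : ℝ} (hx : x ∈ I) :
    omegaSet P.f x = closure (P.phi h.rotNum '' I) := by
  obtain ⟨N, y, -, hlim, -⟩ := h.exists_asymptotic hx
  have hmem := fun z => mem_omegaSet_of_asymptotic (z := z) hlim
  apply Subset.antisymm
  · intro z hz
    rw [Metric.mem_closure_iff]
    intro ε hε
    obtain ⟨n, -, hn⟩ := (hmem z).1 hz 0 ε hε
    exact ⟨_, mem_image_of_mem _ (fract_mem (y + n * h.rotNum)), by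
      rwa [dist_comm, Real.dist_eq]⟩
  · refine closure_minimal ?_ (isClosed_iInter fun _ => isClosed_closure)
    rintro _ ⟨w, hw, rfl⟩
    refine (hmem _).2 fun M ε hε => ?_
    have h1 := (Metric.tendsto_nhds.1 (h.phi_right_continuous h.admissible hw)) ε hε
    obtain ⟨t, ht, hsub⟩ := (mem_nhdsGT_iff_exists_Ioo_subset).1 h1
    obtain ⟨n, hn, hm⟩ := fract_add_nat_mul_mem_Ioo hirr y hw.1 (lt_min ht hw.2)
      (min_le_right _ _) M
    refine ⟨n, hn, ?_⟩
    have := hsub ⟨hm.1, hm.2.trans_le (min_le_left _ _)⟩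
    rwa [mem_ofPred_eq, Real.dist_eq] at this

/-- The closure of the limit set is a Cantor set: `phi` is right continuous and strictly increasing,
so no point of its image is isolated, and it jumps across a dense set of angles, so its image has
gaps everywhere. -/
lemma isCantorSet_irrational (h : P.Facts) (hirr : Irrational h.rotNum) :
    IsCantorSet (closure (P.phi h.rotNum '' I)) := by
  have hJ := h.phi_mem_J_irrational hirr
  have hmono := h.phi_strictMono hirr
  refine ⟨⟨_, subset_closure (mem_image_of_mem _ zero_mem_I)⟩, ?_, ?_, ?_⟩
  · refine (Metric.isBounded_Ico P.c P.b).subset ?_ |>.isCompact_closure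
    rintro _ ⟨y, hy, rfl⟩
    exact hJ hy
  · refine Preperfect.perfect_closure ?_
    rintro _ ⟨y, hy, rfl⟩
    rw [accPt_iff_frequently]
    have h1 : Tendsto (P.phi h.rotNum) (𝓝[>] y) (𝓝 (P.phi h.rotNum y)) :=
      h.phi_right_continuous h.admissible hy
    refine h1.frequently (Eventually.frequently ?_)
    filter_upwards [self_mem_nhdsWithin, nhdsWithin_le_nhds (Iio_mem_nhds hy.2)] with z h2 h3
    have hz : z ∈ I := ⟨hy.1.trans (le_of_lt h2), h3⟩
    exact ⟨(hmono hy hz h2).ne', mem_image_of_mem _ hz⟩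
  · intro S hS hSconn α hα β hβ
    by_contra hne
    wlog hαβ : α < β generalizing α β
    · exact this hβ hα (Ne.symm hne) (lt_of_le_of_ne (not_lt.1 hαβ) (Ne.symm hne))
    have hIcc : Icc α β ⊆ closure (P.phi h.rotNum '' I) :=
      (hSconn.ordConnected.out hα hβ).trans hS
    -- every open subinterval of `[α, β]` contains a value of `phi`
    have hval : ∀ s t, α ≤ s → s < t → t ≤ β → ∃ y ∈ I, P.phi h.rotNum y ∈ Ioo s t := by
      intro s t h1 h2 h3
      obtain ⟨u, hu⟩ := nonempty_Ioo.2 h2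
      obtain ⟨_, hv, ⟨y, hy, rfl⟩⟩ := mem_closure_iff.1
        (hIcc ⟨h1.trans hu.1.le, hu.2.le.trans h3⟩) _ isOpen_Ioo hu
      exact ⟨y, hy, hv⟩
    obtain ⟨m, hm1, hm2⟩ := exists_between hαβ
    obtain ⟨y₁, hy₁, hv₁⟩ := hval α m le_rfl hm1 hm2.le
    obtain ⟨y₂, hy₂, hv₂⟩ := hval m β hm1.le hm2 le_rfl
    have hy12 : y₁ < y₂ := by
      by_contra hcon
      have := hmono.monotoneOn hy₂ hy₁ (not_lt.1 hcon)
      linarith [hv₁.2, hv₂.1]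
    obtain ⟨n, -, hn⟩ := fract_add_nat_mul_mem_Ioo hirr 0 hy₁.1 hy12 hy₂.2.le 0
    rw [zero_add] at hn
    have hr := h.rotNum_mem.1
    set w := Int.fract ((n : ℝ) * h.rotNum) with hw
    have hwI : w ∈ I := fract_mem _
    have hfl : ((⌊(n : ℝ) * h.rotNum⌋₊ : ℕ) : ℝ) = ⌊(n : ℝ) * h.rotNum⌋ :=
      natCast_floor_eq_intCast_floor (by positivity)
    have hwe := Int.fract_add_floor ((n : ℝ) * h.rotNum)
    set e := P.gapLen / P.lam * (P.lam ^ n * P.mu ^ ⌊(n : ℝ) * h.rotNum⌋₊) with he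
    have he0 : 0 < e := h.jump_pos _ _
    have hjump : ∀ y ∈ I, y < w → P.phi h.rotNum y + e ≤ P.phi h.rotNum w := fun y hy hyw =>
      h.phi_jump h.admissible hy hwI (by rw [hfl]; linarith) (by rw [hfl]; linarith)
    have hw1 := hjump y₁ hy₁ hn.1
    have hw2 := hmono hwI hy₂ hn.2
    obtain ⟨y, hy, hv⟩ := hval (P.phi h.rotNum w - e) (P.phi h.rotNum w) (by linarith [hv₁.1])
      (by linarith) (by linarith [hv₂.2])
    rcases lt_or_ge y w with h1 | h1
    · linarith [hjump y hy h1, hv.1]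
    · linarith [hmono.monotoneOn hwI hy h1, hv.2]

end Irrational

end Params.Facts

/-! ### Rational rotation numbers -/

variable {p q : ℕ}

section Grid

lemma gridPts_subset (hq : 0 < q) : gridPts q ⊆ I := by
  rintro _ ⟨m, hm, rfl⟩
  have hq' : (0 : ℝ) < q := by exact_mod_cast hq
  have hm' : (m : ℝ) < q := by exact_mod_cast hm
  exact ⟨by positivity, by rwa [div_lt_one hq']⟩

lemma fract_mem_gridPts (hq : 0 < q) {y : ℝ} {z : ℤ} (hz : q * y = z) :
    Int.fract y ∈ gridPts q := by
  have hq' : (0 : ℝ) < q := by exact_mod_cast hq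
  have h1 : (q : ℝ) * Int.fract y = ((z - q * ⌊y⌋ : ℤ) : ℝ) := by
    rw [Int.fract]; push_cast; rw [← hz]; ring
  have h2 : 0 ≤ z - q * ⌊y⌋ := by
    have : (0 : ℝ) ≤ ((z - q * ⌊y⌋ : ℤ) : ℝ) := by
      rw [← h1]; exact mul_nonneg hq'.le (Int.fract_nonneg y)
    exact_mod_cast this
  obtain ⟨m, hm⟩ := Int.eq_ofNat_of_zero_le h2
  rw [hm, Int.cast_natCast] at h1
  refine ⟨m, ?_, by rw [eq_div_iff hq'.ne']; linarith⟩
  have : (m : ℝ) < q := by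
    rw [← h1]; nlinarith [Int.fract_lt_one y]
  exact_mod_cast this

lemma exists_int_of_fract_mem (hq : 0 < q) {y : ℝ} (hy : Int.fract y ∈ gridPts q) :
    ∃ z : ℤ, (q : ℝ) * y = z := by
  have hq' : (0 : ℝ) < q := by exact_mod_cast hq
  obtain ⟨m, -, hm⟩ := hy
  refine ⟨m + q * ⌊y⌋, ?_⟩
  have := Int.fract_add_floor y
  rw [hm] at this
  have e : (q : ℝ) * y = q * (m / q) + q * ⌊y⌋ := by rw [← mul_add, this]
  rw [e, mul_div_cancel₀ _ hq'.ne']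
  push_cast; ring

/-- The rotation by an integer multiple of `1 / q` preserves the grid. -/
lemma fract_add_mem_gridPts (hq : 0 < q) (y : ℝ) (hy : Int.fract y ∈ gridPts q) (n : ℤ) :
    Int.fract (y + n * ((p : ℝ) / q)) ∈ gridPts q := by
  have hq' : (0 : ℝ) < q := by exact_mod_cast hq
  obtain ⟨z, hz⟩ := exists_int_of_fract_mem hq hy
  refine fract_mem_gridPts hq (z := z + n * p) ?_
  push_cast
  rw [← hz]; field_simp

/-- The rotation by `s / q`, with `s` coprime to `q`, visits every point of the grid infinitely
often. -/
lemma exists_fract_eq (hq : 0 < q) {s : ℤ} (hs : IsCoprime s q) {y : ℝ} {z : ℤ} (hz : q * y = z)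
    {m : ℕ} (hm : m < q) (N : ℕ) :
    ∃ n, N ≤ n ∧ Int.fract (y + n * ((s : ℝ) / q)) = (m : ℝ) / q := by
  have hq' : (0 : ℝ) < q := by exact_mod_cast hq
  have hqz : (0 : ℤ) < q := by exact_mod_cast hq
  obtain ⟨u, v, huv⟩ := hs
  set w : ℤ := ((m - z) * u) % q with hw
  have hw0 : 0 ≤ w := Int.emod_nonneg _ hqz.ne'
  obtain ⟨w', hw'⟩ := Int.eq_ofNat_of_zero_le hw0
  refine ⟨w' + q * N, by nlinarith, ?_⟩
  have hmq : (m : ℝ) < q := by exact_mod_cast hm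
  rw [Int.fract_eq_iff]
  refine ⟨by positivity, by rwa [div_lt_one hq'],
    N * s - (m - z) * v - s * (((m - z) * u) / q), ?_⟩
  have h1 : (w : ℝ) + q * ((((m - z) * u) / q : ℤ) : ℝ) = (m - z) * u := by
    have := Int.emod_add_mul_ediv ((m - z) * u) q
    rw [← hw] at this
    exact_mod_cast this
  have h2 : (u : ℝ) * s + v * q = 1 := by exact_mod_cast huv
  have h3 : (w : ℝ) = w' := by rw [hw']; simp
  have h4 : y = z / q := by rw [eq_div_iff hq'.ne', ← hz]; ring
  rw [h4]
  push_cast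
  rw [← h3]
  field_simp
  linear_combination (s : ℝ) * h1 + ((m : ℝ) - z) * h2

lemma gridPts_finite : (gridPts q).Finite := by
  refine ((Set.finite_Iio q).image fun m : ℕ => (m : ℝ) / q).subset ?_
  rintro _ ⟨m, hm, rfl⟩
  exact ⟨m, hm, rfl⟩

lemma isCoprime_cast (hpq : p.Coprime q) : IsCoprime (p : ℤ) q :=
  Nat.isCoprime_iff_coprime.2 hpq

end Grid

namespace Params.Facts

/-- For a rational angle, `phi` is constant between consecutive points of the grid. -/
lemma phi_eq_phi_grid (h : P.Facts) (hq : 0 < q) {y : ℝ} (hy : y ∈ I) :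
    ∃ w ∈ gridPts q, P.phi ((p : ℝ) / q) y = P.phi ((p : ℝ) / q) w := by
  have hq' : (0 : ℝ) < q := by exact_mod_cast hq
  have hqy : 0 ≤ (q : ℝ) * y := mul_nonneg hq'.le hy.1
  set m := ⌊(q : ℝ) * y⌋₊ with hm
  have h1 : (m : ℝ) ≤ q * y := Nat.floor_le hqy
  have h2 : (q : ℝ) * y < m + 1 := Nat.lt_floor_add_one _
  have hmq : m < q := by
    have : (m : ℝ) < q := by nlinarith [hy.2]
    exact_mod_cast this
  have hw : (m : ℝ) / q ∈ gridPts q := ⟨m, hmq, rfl⟩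
  refine ⟨_, hw, ?_⟩
  rw [h.phi_eq hy, h.phi_eq (gridPts_subset hq hw)]
  congr 2
  refine tsum_congr fun k => ?_
  congr 2
  refine le_antisymm (Nat.ceil_mono ?_) (Nat.ceil_le.2 ?_)
  · have : (m : ℝ) / q ≤ y := by rw [div_le_iff₀ hq']; linarith
    linarith
  · have h3 := Nat.le_ceil ((k : ℝ) * (p / q) + -y)
    set n := ⌈(k : ℝ) * (p / q) + -y⌉₊
    have h4 : (k : ℝ) * p < n * q + (m + 1) := by
      have e : (k : ℝ) * p = (k * (p / q) + -y) * q + q * y := by field_simp; ring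
      rw [e]
      nlinarith
    have h5 : k * p ≤ n * q + m := by
      have : k * p < n * q + (m + 1) := by exact_mod_cast h4
      omega
    have h6 : (k : ℝ) * p ≤ n * q + m := by exact_mod_cast h5
    have e : (k : ℝ) * (p / q) + -((m : ℝ) / q) = (k * p - m) / q := by ring
    rw [e, div_le_iff₀ hq']
    linarith

lemma phi_image_I (h : P.Facts) (hq : 0 < q) :
    P.phi ((p : ℝ) / q) '' I = P.phi ((p : ℝ) / q) '' gridPts q := by
  apply Subset.antisymm
  · rintro _ ⟨y, hy, rfl⟩
    obtain ⟨w, hw, e⟩ := h.phi_eq_phi_grid hq hy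
    exact ⟨w, hw, e.symm⟩
  · exact image_mono (gridPts_subset hq)

/-- `phi` jumps at every point of the grid except `0`. -/
lemma phi_strictMonoOn_grid (h : P.Facts) (hq : 0 < q) (hpq : p.Coprime q)
    (ha : Admissible P.lam P.mu ((p : ℝ) / q)) :
    StrictMonoOn (P.phi ((p : ℝ) / q)) (gridPts q) := by
  have hq' : (0 : ℝ) < q := by exact_mod_cast hq
  rintro _ hy _ ⟨m, hm, rfl⟩ hlt
  obtain ⟨n, hn, hf⟩ := exists_fract_eq hq (isCoprime_cast hpq) (y := 0) (z := 0) (by simp) hm 0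
  rw [zero_add, Int.cast_natCast] at hf
  have hnn : 0 ≤ (n : ℝ) * ((p : ℝ) / q) := by positivity
  have hfl : ((⌊(n : ℝ) * ((p : ℝ) / q)⌋₊ : ℕ) : ℝ) = ⌊(n : ℝ) * ((p : ℝ) / q)⌋ :=
    natCast_floor_eq_intCast_floor hnn
  have he := Int.fract_add_floor ((n : ℝ) * ((p : ℝ) / q))
  rw [hf] at he
  have h2 := h.phi_jump ha (gridPts_subset hq hy) (gridPts_subset hq ⟨m, hm, rfl⟩) (k := n)
    (l := ⌊(n : ℝ) * ((p : ℝ) / q)⌋₊) (by rw [hfl]; linarith) (by rw [hfl]; linarith)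
  linarith [h.jump_pos n ⌊(n : ℝ) * ((p : ℝ) / q)⌋₊]

/-- The value of `phi` at the last point of the grid is `b` exactly at the right endpoint of the
parameter interval. -/
lemma phi_last_eq_iff (h : P.Facts) (hq : 0 < q) (ha : Admissible P.lam P.mu ((p : ℝ) / q)) :
    P.phi ((p : ℝ) / q) (((q - 1 : ℕ) : ℝ) / q) = P.b ↔
      P.a = aFun P.lam P.mu P.b P.c ((p : ℝ) / q) := by
  have hq' : (0 : ℝ) < q := by exact_mod_cast hq
  have hl := h.lam_pos
  have hl1 : 0 < 1 - P.lam := by linarith [h.lam_lt]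
  have hc : ((q - 1 : ℕ) : ℝ) = q - 1 := by push_cast [Nat.cast_sub hq]; ring
  -- `⌈(k p + 1 - q) / q⌉₊` is the integer part of `k p / q`
  have hPhi : Phi ((p : ℝ) / q) P.lam P.mu (-(((q - 1 : ℕ) : ℝ) / q))
      = ∑' k : ℕ, geo P.lam P.mu k ⌊(k : ℝ) * ((p : ℝ) / q)⌋₊ := by
    refine tsum_congr fun k => ?_
    change geo _ _ _ _ = _
    congr 1
    have hk0 : 0 ≤ (k : ℝ) * ((p : ℝ) / q) := by positivity
    set n := ⌊(k : ℝ) * ((p : ℝ) / q)⌋₊ with hn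
    have h1 : (n : ℝ) ≤ k * (p / q) := Nat.floor_le hk0
    have h2 : (k : ℝ) * (p / q) < n + 1 := Nat.lt_floor_add_one _
    have e : (k : ℝ) * ((p : ℝ) / q) = k * p / q := by ring
    rw [e, le_div_iff₀ hq'] at h1
    rw [e, div_lt_iff₀ hq'] at h2
    have h3 : k * p + 1 ≤ (n + 1) * q := by
      have : k * p < (n + 1) * q := by exact_mod_cast h2
      omega
    have h4 : (k : ℝ) * p + 1 ≤ (n + 1) * q := by exact_mod_cast h3
    have e2 : (k : ℝ) * ((p : ℝ) / q) + -(((q - 1 : ℕ) : ℝ) / q) = (k * p + 1 - q) / q := by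
      rw [hc]; field_simp; ring
    rw [e2]
    apply le_antisymm
    · rw [Nat.ceil_le, div_le_iff₀ hq']; linarith
    · rcases Nat.eq_zero_or_pos n with h0 | h0
      · omega
      · refine Nat.le_of_pred_lt (Nat.lt_ceil.2 ?_)
        rw [lt_div_iff₀ hq', ← Nat.sub_one, Nat.cast_sub h0]
        push_cast
        linarith
  have hs := ha.sigma_eq
  have hden := ha.denom_sigma_pos
  have hlast : ((q - 1 : ℕ) : ℝ) / q ∈ I := gridPts_subset hq ⟨q - 1, by omega, rfl⟩
  rw [h.phi_eq hlast, hPhi, aFun, aOfSigma, eq_div_iff hden.ne']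
  set Ψ := ∑' k : ℕ, geo P.lam P.mu k ⌊(k : ℝ) * ((p : ℝ) / q)⌋₊
  set s := sigma P.lam P.mu ((p : ℝ) / q)
  have e : P.a / (1 - P.lam) - P.gapLen / P.lam * Ψ = (P.a - P.gapLen * s) / (1 - P.lam) := by
    rw [eq_div_iff hl1.ne']
    field_simp
    linear_combination P.gapLen * hs
  have hg := h.gapLen_eq
  rw [e, div_eq_iff hl1.ne']
  constructor
  · intro h1; linear_combination h1 + s * hg
  · intro h1; linear_combination h1 - s * hg

lemma sub_mem_gridPts {j k : ℕ} (hkj : k ≤ j) (hj : j < q) :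
    (j : ℝ) / q - (k : ℝ) / q ∈ gridPts q :=
  ⟨j - k, by omega, by rw [Nat.cast_sub hkj]; ring⟩

section Rational

lemma lt_of_rotNum (h : P.Facts) (hq : 0 < q) (hr : h.rotNum = (p : ℝ) / q) : p < q := by
  have h1 := h.rotNum_mem.2
  have hq' : (0 : ℝ) < q := by exact_mod_cast hq
  rw [hr, div_lt_one hq'] at h1
  exact_mod_cast h1

/-- Comparison with the orbit of `c` places the grid values of `phi` on the two sides of the break
point, up to equality on the left. -/
lemma phi_grid_side (h : P.Facts) (hq : 0 < q) (hpq : p.Coprime q)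
    (hr : h.rotNum = (p : ℝ) / q) {y : ℝ} (hy : y ∈ gridPts q) :
    (y < 1 - (p : ℝ) / q → P.phi ((p : ℝ) / q) y ≤ P.eta) ∧
      (1 - (p : ℝ) / q ≤ y → P.eta ≤ P.phi ((p : ℝ) / q) y) := by
  have hq' : (0 : ℝ) < q := by exact_mod_cast hq
  obtain ⟨N, y₀, hbr, hlim, hlat⟩ := h.exists_asymptotic (h.J_subset h.c_mem)
  obtain ⟨z, hz⟩ := hlat q p (by rw [hr]; field_simp)
  rw [hr] at hbr hlim
  obtain ⟨m, hm, rfl⟩ := hy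
  have key : ∀ ε > 0, ∃ n, Int.fract (y₀ + (n : ℕ) * ((p : ℝ) / q)) = (m : ℝ) / q ∧
      |P.f^[N + n] P.c - P.phi ((p : ℝ) / q) ((m : ℝ) / q)| < ε := by
    intro ε hε
    obtain ⟨K, hK⟩ := Metric.tendsto_atTop.1 hlim ε hε
    obtain ⟨n, hn, hf⟩ := exists_fract_eq hq (isCoprime_cast hpq) hz hm K
    rw [Int.cast_natCast] at hf
    have h3 := hK n hn
    rw [Real.dist_eq, sub_zero, hf] at h3
    exact ⟨n, hf, h3⟩
  constructor
  · intro h1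
    refine le_of_forall_pos_le_add fun ε hε => ?_
    obtain ⟨n, hf, h3⟩ := key ε hε
    have h4 := (hbr n).2 (by rwa [hf])
    linarith [(abs_lt.1 h3).1]
  · intro h1
    refine le_of_forall_pos_le_add fun ε hε => ?_
    obtain ⟨n, hf, h3⟩ := key ε hε
    have h4 := mt (hbr n).1 (not_lt.2 (by rwa [hf]))
    linarith [(abs_lt.1 h3).2, not_lt.1 h4]

/-- Every orbit accumulates exactly at the grid values of `phi`. -/
lemma omegaSet_rational (h : P.Facts) (hq : 0 < q) (hpq : p.Coprime q)
    (hr : h.rotNum = (p : ℝ) / q) {x : ℝ} (hx : x ∈ I) :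
    omegaSet P.f x = P.phi ((p : ℝ) / q) '' gridPts q := by
  have hq' : (0 : ℝ) < q := by exact_mod_cast hq
  obtain ⟨N, y, -, hlim, hlat⟩ := h.exists_asymptotic hx
  obtain ⟨z, hz⟩ := hlat q p (by rw [hr]; field_simp)
  rw [hr] at hlim
  have hmem := fun z => mem_omegaSet_of_asymptotic (z := z) hlim
  apply Subset.antisymm
  · intro w hw
    rw [← (gridPts_finite.image _).isClosed.closure_eq, Metric.mem_closure_iff]
    intro ε hε
    obtain ⟨n, -, hn⟩ := (hmem w).1 hw 0 ε hε
    exact ⟨_, mem_image_of_mem _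
      (by simpa using fract_add_mem_gridPts (p := p) hq y (fract_mem_gridPts hq hz) n), by
        rwa [dist_comm, Real.dist_eq]⟩
  · rintro _ ⟨_, ⟨m, hm, rfl⟩, rfl⟩
    refine (hmem _).2 fun M ε hε => ?_
    obtain ⟨n, hn, hf⟩ := exists_fract_eq hq (isCoprime_cast hpq) hz hm M
    rw [Int.cast_natCast] at hf
    exact ⟨n, hn, by rwa [hf, sub_self, abs_zero]⟩

/-- If the last grid value of `phi` is not `b`, the grid values lie strictly on the correct sides of
the break point and inside `[c, b)`. -/
lemma phi_grid_of_ne (h : P.Facts) (hp : 0 < p) (hq : 0 < q) (hpq : p.Coprime q)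
    (hr : h.rotNum = (p : ℝ) / q)
    (hne : P.phi ((p : ℝ) / q) (((q - 1 : ℕ) : ℝ) / q) ≠ P.b) :
    (∀ y ∈ gridPts q, P.f (P.phi ((p : ℝ) / q) y) = P.phi ((p : ℝ) / q) (rot ((p : ℝ) / q) y)) ∧
      MapsTo (P.phi ((p : ℝ) / q)) (gridPts q) P.J := by
  have hq' : (0 : ℝ) < q := by exact_mod_cast hq
  have hplt := h.lt_of_rotNum hq hr
  have ha := h.admissible
  have hr0 := h.rotNum_mem.1
  rw [hr] at ha hr0
  have hside := fun y (hy : y ∈ gridPts q) => h.phi_grid_side hq hpq hr hy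
  have hc : ((q - 1 : ℕ) : ℝ) = q - 1 := by push_cast [Nat.cast_sub hq]; ring
  -- the preimage of the last grid point under the rotation
  set t : ℝ := ((q - 1 : ℕ) : ℝ) / q - (p : ℝ) / q with ht
  have htg : t ∈ gridPts q := sub_mem_gridPts (by omega) (by omega)
  have ht1 : t < 1 - (p : ℝ) / q := by
    rw [ht, hc, sub_div, div_self hq'.ne']
    have : 0 < 1 / (q : ℝ) := by positivity
    linarith
  have hlast : P.phi ((p : ℝ) / q) (((q - 1 : ℕ) : ℝ) / q)
      = P.lam * P.phi ((p : ℝ) / q) t + P.a := by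
    rw [← h.phi_left ha (gridPts_subset hq htg).1 ht1, ht, sub_add_cancel]
  have hteta : P.phi ((p : ℝ) / q) t < P.eta := by
    refine lt_of_le_of_ne ((hside t htg).1 ht1) fun h1 => hne ?_
    rw [hlast, h1, h.a_eq]; ring
  have hlastb : P.phi ((p : ℝ) / q) (((q - 1 : ℕ) : ℝ) / q) < P.b := by
    rw [hlast]; exact h.f_left_lt hteta
  have hmono := (h.phi_strictMonoOn_grid hq hpq ha).monotoneOn
  refine ⟨fun y hy => ?_, fun y hy => ⟨?_, ?_⟩⟩
  · refine h.f_phi ha (gridPts_subset hq hy) (fun h1 => ?_) (hside y hy).2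
    refine lt_of_le_of_lt (hmono hy htg ?_) hteta
    obtain ⟨m, hm, rfl⟩ := hy
    have h2 : (m : ℝ) < q - p := by
      rw [div_lt_iff₀ hq', sub_mul, div_mul_cancel₀ _ hq'.ne', one_mul] at h1
      exact h1
    have h3 : m + p + 1 ≤ q := by
      have : (m : ℝ) + p < q := by linarith
      have : m + p < q := by exact_mod_cast this
      omega
    have h4 : (m : ℝ) + p + 1 ≤ q := by exact_mod_cast h3
    rw [ht, hc, ← sub_div]
    gcongr
    linarith
  · have h1g : 1 - (p : ℝ) / q ∈ gridPts q := by
      refine ⟨q - p, by omega, ?_⟩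
      rw [Nat.cast_sub hplt.le, sub_div, div_self hq'.ne']
    have h1 := (hside _ h1g).2 le_rfl
    have h2 := h.phi_right ha (y := 1 - (p : ℝ) / q) le_rfl (by linarith)
    rw [show 1 - (p : ℝ) / q + (p : ℝ) / q - 1 = 0 by ring] at h2
    have h3 := mul_nonneg h.slope_pos.le (sub_nonneg.2 h1)
    linarith [(h.phi_bounds ha (gridPts_subset hq hy)).1]
  · refine lt_of_le_of_lt (hmono hy ⟨q - 1, by omega, rfl⟩ ?_) hlastb
    obtain ⟨m, hm, rfl⟩ := hy
    gcongr
    omega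

lemma lattice_mem_gridPts (h : P.Facts) (hq : 0 < q) (hr : h.rotNum = (p : ℝ) / q) {y : ℝ}
    (hy : ∀ q p : ℕ, (q : ℝ) * h.rotNum = p → ∃ z : ℤ, q * y = z) : Int.fract y ∈ gridPts q := by
  have hq' : (0 : ℝ) < q := by exact_mod_cast hq
  obtain ⟨z, hz⟩ := hy q p (by rw [hr]; field_simp)
  exact fract_mem_gridPts hq hz

lemma limitSet_rational (h : P.Facts) (hp : 0 < p) (hq : 0 < q) (hpq : p.Coprime q)
    (hr : h.rotNum = (p : ℝ) / q)
    (hne : P.phi ((p : ℝ) / q) (((q - 1 : ℕ) : ℝ) / q) ≠ P.b) :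
    limitSet P.f = P.phi ((p : ℝ) / q) '' gridPts q := by
  obtain ⟨hconj, hJ⟩ := h.phi_grid_of_ne hp hq hpq hr hne
  rw [← hr] at hconj hJ ⊢
  refine h.limitSet_eq (gridPts_subset hq) (fun y hy n => ?_) hconj hJ
    fun y hy => h.lattice_mem_gridPts hq hr hy
  rw [hr]
  exact fract_add_mem_gridPts hq y hy n

lemma isCycle_rational (h : P.Facts) (hp : 0 < p) (hq : 0 < q) (hpq : p.Coprime q)
    (hr : h.rotNum = (p : ℝ) / q)
    (hne : P.phi ((p : ℝ) / q) (((q - 1 : ℕ) : ℝ) / q) ≠ P.b) :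
    IsCycle P.f q (P.phi ((p : ℝ) / q) '' gridPts q) := by
  have hq' : (0 : ℝ) < q := by exact_mod_cast hq
  obtain ⟨hconj, -⟩ := h.phi_grid_of_ne hp hq hpq hr hne
  have ha := h.admissible
  rw [hr] at ha
  have h0 : (0 : ℝ) ∈ gridPts q := ⟨0, hq, by simp⟩
  have hit : ∀ n, P.f^[n] (P.phi ((p : ℝ) / q) 0)
      = P.phi ((p : ℝ) / q) (Int.fract (n * ((p : ℝ) / q))) := by
    intro n
    have := Params.iterate_phi (gridPts_subset hq) (fract_add_mem_gridPts hq) hconj h0 n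
    rwa [zero_add] at this
  have hgrid : ∀ n : ℕ, Int.fract (n * ((p : ℝ) / q)) ∈ gridPts q := fun n => by
    simpa using fract_add_mem_gridPts (p := p) hq 0 (by simpa using h0) n
  have hper : ∀ n : ℕ, P.f^[n] (P.phi ((p : ℝ) / q) 0) = P.phi ((p : ℝ) / q) 0 ↔ q ∣ n := by
    intro n
    rw [hit, (h.phi_strictMonoOn_grid hq hpq ha).injOn.eq_iff (hgrid n) h0, Int.fract_eq_iff]
    constructor
    · rintro ⟨-, -, z, hz⟩
      have e : (n : ℤ) * p = z * q := by
        have : (n : ℝ) * p = z * q := by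
          rw [← hz, sub_zero]; field_simp
        exact_mod_cast this
      have := (isCoprime_cast hpq).symm.dvd_of_dvd_mul_right ⟨z, by rw [e, mul_comm]⟩
      exact_mod_cast this
    · rintro ⟨k, rfl⟩
      refine ⟨le_rfl, one_pos, k * p, ?_⟩
      push_cast; field_simp; ring
  refine ⟨hq, _, mem_image_of_mem _ h0, ?_, ?_⟩
  · apply Nat.dvd_antisymm
    · exact Function.IsPeriodicPt.minimalPeriod_dvd ((hper q).2 dvd_rfl)
    · exact (hper _).1 (Function.isPeriodicPt_minimalPeriod P.f _)
  · ext x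
    constructor
    · rintro ⟨_, ⟨m, hm, rfl⟩, rfl⟩
      obtain ⟨n, -, hf⟩ := exists_fract_eq hq (isCoprime_cast hpq) (y := 0) (z := 0)
        (by simp) hm 0
      rw [zero_add, Int.cast_natCast] at hf
      exact ⟨n, by rw [hit, hf]⟩
    · rintro ⟨n, rfl⟩
      rw [hit]
      exact mem_image_of_mem _ (hgrid n)

/-- When the last grid value of `phi` is `b`, a point of the limit set would have a backward orbit
through `b`, which is not in `[c, b)`. -/
lemma limitSet_endpoint (h : P.Facts) (hq : 0 < q) (hpq : p.Coprime q)
    (hr : h.rotNum = (p : ℝ) / q)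
    (hb : P.phi ((p : ℝ) / q) (((q - 1 : ℕ) : ℝ) / q) = P.b) : limitSet P.f = ∅ := by
  have hq' : (0 : ℝ) < q := by exact_mod_cast hq
  refine eq_empty_of_forall_notMem fun x hx => ?_
  obtain ⟨X, -, hXJ, hfX⟩ := h.exists_backward_orbit hx
  obtain ⟨N, y, h1, h2⟩ := h.exists_backward hXJ hfX
  obtain ⟨z, hz⟩ := h2 q p (by rw [hr]; field_simp)
  obtain ⟨n, hn, hf⟩ := exists_fract_eq hq (s := -p) (isCoprime_cast hpq).neg_left hz
    (m := q - 1) (by omega) N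
  have h3 := h1 n hn
  rw [hr, show y - n * ((p : ℝ) / q) = y + n * (((-p : ℤ) : ℝ) / q) by push_cast; ring, hf,
    hb] at h3
  exact absurd (hXJ n).2 (by rw [h3]; exact lt_irrefl _)

end Rational

/-- When the last grid value of `phi` is `b`, points slightly to the left of `b` follow the rotation
by `p / q`, which is therefore the rotation number. -/
lemma rotNum_endpoint (h : P.Facts) (hq : 0 < q) (hpq : p.Coprime q)
    (ha : Admissible P.lam P.mu ((p : ℝ) / q))
    (hb : P.phi ((p : ℝ) / q) (((q - 1 : ℕ) : ℝ) / q) = P.b) : h.rotNum = (p : ℝ) / q := by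
  have hq' : (0 : ℝ) < q := by exact_mod_cast hq
  have hplt : p < q := by
    have := ha.r_lt
    rw [div_lt_one hq'] at this
    exact_mod_cast this
  have hp : 0 < p := by
    rcases Nat.eq_zero_or_pos p with rfl | h0
    · have := ha.r_pos; simp at this
    · exact h0
  set r : ℝ := (p : ℝ) / q with hr
  have hc : ((q - 1 : ℕ) : ℝ) = q - 1 := by push_cast [Nat.cast_sub hq]; ring
  set y₀ : ℝ := ((q - 1 : ℕ) : ℝ) / q with hy₀
  have hmono := h.phi_strictMonoOn_grid hq hpq ha
  have hy₀g : y₀ ∈ gridPts q := ⟨q - 1, by omega, rfl⟩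
  have hy₀I := gridPts_subset hq hy₀g
  set t : ℝ := y₀ - r with ht
  have htg : t ∈ gridPts q := sub_mem_gridPts (by omega) (by omega)
  have hye : y₀ = 1 - 1 / q := by rw [hy₀, hc, sub_div, div_self hq'.ne']
  have hqi : 0 < 1 / (q : ℝ) := by positivity
  have ht1 : t < 1 - r := by linarith
  have hphit : P.phi r t = P.eta := by
    have h1 := h.phi_left ha (gridPts_subset hq htg).1 ht1
    rw [ht, sub_add_cancel, hb, h.a_eq] at h1
    exact mul_left_cancel₀ h.lam_pos.ne' (by rw [ht]; linarith)
  have h1g : 1 - r ∈ gridPts q := by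
    refine ⟨q - p, by omega, ?_⟩
    rw [Nat.cast_sub hplt.le, sub_div, div_self hq'.ne']
  have hgt : P.eta < P.phi r (1 - r) := by rw [← hphit]; exact hmono htg h1g ht1
  have hleft : ∀ y ∈ gridPts q, y < 1 - r → P.phi r y ≤ P.eta := by
    intro y hy hy1
    rw [← hphit]
    refine hmono.monotoneOn hy htg ?_
    obtain ⟨m, hm, rfl⟩ := hy
    have h2 : (m : ℝ) < q - p := by
      rw [hr, div_lt_iff₀ hq', sub_mul, div_mul_cancel₀ _ hq'.ne', one_mul] at hy1
      exact hy1
    have h3 : m + p + 1 ≤ q := by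
      have : (m : ℝ) + p < q := by linarith
      have : m + p < q := by exact_mod_cast this
      omega
    have h4 : (m : ℝ) + p + 1 ≤ q := by exact_mod_cast h3
    rw [ht, hy₀, hc, ← sub_div]
    gcongr
    linarith
  -- a bound for all products of slopes along the rotation of `y₀`
  have hS : ∀ n : ℕ, ((⌊y₀ + n * r⌋₊ : ℕ) : ℝ) ≤ n * r + 1 := fun n => by
    have := ha.r_pos
    have := Nat.floor_le (show 0 ≤ y₀ + n * r by have := hy₀I.1; positivity)
    linarith [hy₀I.2]
  obtain ⟨K, hK⟩ := (ha.tendsto_slope hS).bddAbove_range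
  have hK' : ∀ n : ℕ, P.lam ^ n * P.mu ^ ⌊y₀ + n * r⌋₊ ≤ K := fun n => hK ⟨n, rfl⟩
  have hK0 : 0 < K := lt_of_lt_of_le
    (by have := h.lam_pos; have := h.mu_pos; positivity) (hK' 0)
  set ε := min (P.b - P.c) ((P.phi r (1 - r) - P.eta) / K) with hε
  have hε0 : 0 < ε := lt_min h.len_pos (div_pos (by linarith) hK0)
  have hε1 : ε ≤ P.b - P.c := min_le_left _ _
  have hε2 : K * ε ≤ P.phi r (1 - r) - P.eta := by
    rw [mul_comm, ← le_div_iff₀ hK0]; exact min_le_right _ _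
  have hx₀ : P.b - ε ∈ P.J := ⟨by linarith, by linarith⟩
  have hfl0 : ⌊y₀⌋ = 0 := Int.floor_eq_zero_iff.2 hy₀I
  have hfr0 : Int.fract y₀ = y₀ := Int.fract_eq_self.2 hy₀I
  have hfol : ∀ n, P.Follows r (P.b - ε) y₀ n := by
    intro n
    induction n with
    | zero =>
      intro m hm
      obtain rfl : m = 0 := by omega
      simp [Params.visits]
    | succ n ih =>
      intro m hm
      rcases Nat.lt_or_ge m (n + 1) with h1 | h1
      · exact ih m (by omega)
      obtain rfl : m = n + 1 := by omega
      have h2 := h.follows_sub ha ih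
      have h3 := ih n le_rfl
      have h3' : P.visits n (P.b - ε) = ⌊y₀ + n * r⌋₊ := by
        rw [hfl0, sub_zero] at h3
        rw [← Int.floor_toNat, ← h3, Int.toNat_natCast]
      rw [hfr0, hb, h3'] at h2
      have hslope : 0 < P.lam ^ n * P.mu ^ ⌊y₀ + n * r⌋₊ := by
        have := h.lam_pos; have := h.mu_pos; positivity
      have hd1 : P.lam ^ n * P.mu ^ ⌊y₀ + n * r⌋₊ * ε ≤ K * ε :=
        mul_le_mul_of_nonneg_right (hK' n) hε0.le
      have hd0 : 0 < P.lam ^ n * P.mu ^ ⌊y₀ + n * r⌋₊ * ε := mul_pos hslope hε0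
      have hwg : Int.fract (y₀ + n * r) ∈ gridPts q := by
        have := fract_add_mem_gridPts (p := p) hq y₀ (by rwa [hfr0]) n
        rwa [Int.cast_natCast] at this
      rw [show y₀ + ((n + 1 : ℕ) : ℝ) * r = (y₀ + n * r) + r by push_cast; ring, Params.visits]
      rcases lt_or_ge (Int.fract (y₀ + n * r)) (1 - r) with h4 | h4
      · have h5 := hleft _ hwg h4
        rw [(fract_rot_left ha.r_pos h4).2, if_pos (by linarith)]
        push_cast
        linarith
      · have h5 := hmono.monotoneOn h1g hwg h4
        rw [(fract_rot_right ha.r_lt h4).2, if_neg (not_lt.2 (by linarith))]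
        push_cast
        linarith
  have hlim1 : Tendsto (fun n : ℕ => (P.visits n (P.b - ε) : ℝ) / n) atTop (𝓝 h.rotNum) :=
    tendsto_div_of_abs_sub_le (M := 0) fun n _ => h.abs_visits_sub_le hx₀ n
  have hlim2 : Tendsto (fun n : ℕ => (P.visits n (P.b - ε) : ℝ) / n) atTop (𝓝 r) := by
    refine tendsto_div_of_abs_sub_le (M := 0) (C := 1) fun n _ => ?_
    have h1 := hfol n n le_rfl
    rw [hfl0, sub_zero] at h1
    have h2 : (P.visits n (P.b - ε) : ℝ) = ⌊y₀ + n * r⌋ := by exact_mod_cast h1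
    have h3 := Int.floor_le (y₀ + n * r)
    have h4 := Int.lt_floor_add_one (y₀ + n * r)
    rw [h2, abs_le]
    constructor <;> linarith [hy₀I.1, hy₀I.2]
  exact tendsto_nhds_unique hlim1 hlim2

end Params.Facts

end TwoInterval

theorem mainTheorem3 (P : TwoInterval.Params) (hP : P ∈ TwoInterval.paramSet) :
    -- the map sends `I` to `I`, and its rotation number exists
    MapsTo P.f TwoInterval.I TwoInterval.I ∧
    (∃ rho : ℝ, P.IsRotationNumber rho) ∧
    -- the explicit one-sided values are the left limits that they denote
    (∀ p q : ℕ, 0 < p → 0 < q → p.Coprime q →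
      (p : ℝ) / q < TwoInterval.rMax P.lam P.mu →
      Tendsto (fun r => TwoInterval.aFun P.lam P.mu P.b P.c r) (𝓝[<] ((p : ℝ) / q))
        (𝓝 (TwoInterval.aLeft P.lam P.mu P.b P.c p q))) ∧
    ∀ rho : ℝ, P.IsRotationNumber rho →
      -- `φ` is well defined
      (0 < rho ∧ rho < TwoInterval.rMax P.lam P.mu ∧ rho < 1 ∧ P.lam * P.mu ^ rho < 1) ∧
      -- irrational rotation number
      (Irrational rho →
        TwoInterval.limitSet P.f = P.phi rho '' TwoInterval.I ∧
        TwoInterval.IsCantorSet (closure (TwoInterval.limitSet P.f)) ∧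
        (∀ x ∈ TwoInterval.I,
          TwoInterval.omegaSet P.f x = closure (TwoInterval.limitSet P.f)) ∧
        BijOn (P.phi rho) TwoInterval.I (TwoInterval.limitSet P.f) ∧
        MapsTo P.f (TwoInterval.limitSet P.f) (TwoInterval.limitSet P.f) ∧
        ∀ y ∈ TwoInterval.I, P.f (P.phi rho y) = P.phi rho (TwoInterval.rot rho y)) ∧
      -- rational rotation number, half-open parameter interval
      (∀ p q : ℕ, 0 < p → 0 < q → p.Coprime q → rho = (p : ℝ) / q →
        TwoInterval.aLeft P.lam P.mu P.b P.c p q ≤ P.a →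
        P.a < TwoInterval.aFun P.lam P.mu P.b P.c ((p : ℝ) / q) →
        TwoInterval.limitSet P.f = P.phi rho '' TwoInterval.I ∧
        TwoInterval.limitSet P.f = P.phi rho '' TwoInterval.gridPts q ∧
        (∀ x ∈ TwoInterval.I, TwoInterval.omegaSet P.f x = TwoInterval.limitSet P.f) ∧
        TwoInterval.IsCycle P.f q (TwoInterval.limitSet P.f) ∧
        BijOn (P.phi rho) (TwoInterval.gridPts q) (TwoInterval.limitSet P.f) ∧
        MapsTo P.f (TwoInterval.limitSet P.f) (TwoInterval.limitSet P.f) ∧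
        MapsTo (TwoInterval.rot ((p : ℝ) / q)) (TwoInterval.gridPts q)
          (TwoInterval.gridPts q) ∧
        ∀ y ∈ TwoInterval.gridPts q,
          P.f (P.phi rho y) = P.phi rho (TwoInterval.rot ((p : ℝ) / q) y)) ∧
      -- the endpoint
      (∀ p q : ℕ, 0 < p → 0 < q → p.Coprime q →
        (p : ℝ) / q < TwoInterval.rMax P.lam P.mu →
        P.a = TwoInterval.aFun P.lam P.mu P.b P.c ((p : ℝ) / q) →
        TwoInterval.limitSet P.f = ∅ ∧
        (P.phi rho '' TwoInterval.I).Finite ∧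
        P.b ∈ P.phi rho '' TwoInterval.I ∧
        ∀ x ∈ TwoInterval.I, TwoInterval.omegaSet P.f x = P.phi rho '' TwoInterval.I) := by
  have h := TwoInterval.Params.facts hP
  refine ⟨h.mapsTo_I, ⟨_, h.isRotationNumber⟩, ?_, ?_⟩
  · intro p q hp hq hpq hlt
    exact TwoInterval.tendsto_aFun_left hq hp hpq
      (TwoInterval.admissible_of_lt_rMax h.lam_pos h.lam_lt h.mu_pos (by positivity) hlt)
  intro rho hrho
  obtain rfl := h.eq_rotNum hrho
  have ha := h.admissible
  refine ⟨⟨ha.r_pos, ha.lt_rMax, ha.r_lt, ha.conv⟩, ?_, ?_, ?_⟩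
  · intro hirr
    have hC := h.limitSet_irrational hirr
    have hconj := h.f_phi_irrational hirr
    rw [hC]
    refine ⟨rfl, h.isCantorSet_irrational hirr, fun x hx => h.omegaSet_irrational hirr hx,
      (h.phi_strictMono hirr).injOn.bijOn_image, ?_, hconj⟩
    rintro _ ⟨y, hy, rfl⟩
    exact ⟨_, TwoInterval.fract_mem _, (hconj y hy).symm⟩
  · intro p q hp hq hpq hr _ hlt
    have ha' := ha
    rw [hr] at ha' ⊢
    have hne := mt (h.phi_last_eq_iff hq ha').1 hlt.ne
    have hC := h.limitSet_rational hp hq hpq hr hne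
    have hconj := (h.phi_grid_of_ne hp hq hpq hr hne).1
    have hrot : MapsTo (TwoInterval.rot ((p : ℝ) / q)) (TwoInterval.gridPts q)
        (TwoInterval.gridPts q) :=
      TwoInterval.rot_mem (TwoInterval.gridPts_subset hq) (TwoInterval.fract_add_mem_gridPts hq)
    rw [hC]
    refine ⟨(h.phi_image_I hq).symm, rfl, fun x hx => h.omegaSet_rational hq hpq hr hx,
      h.isCycle_rational hp hq hpq hr hne,
      (h.phi_strictMonoOn_grid hq hpq ha').injOn.bijOn_image, ?_, hrot, hconj⟩
    rintro _ ⟨y, hy, rfl⟩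
    exact ⟨_, hrot hy, (hconj y hy).symm⟩
  · intro p q hp hq hpq hlt hae
    have ha' := TwoInterval.admissible_of_lt_rMax h.lam_pos h.lam_lt h.mu_pos
      (show 0 < (p : ℝ) / q by positivity) hlt
    have hb := (h.phi_last_eq_iff hq ha').2 hae
    have hr := h.rotNum_endpoint hq hpq ha' hb
    rw [hr, h.phi_image_I hq]
    exact ⟨h.limitSet_endpoint hq hpq hr hb, TwoInterval.gridPts_finite.image _,
      ⟨_, ⟨q - 1, by omega, rfl⟩, hb⟩, fun x hx => h.omegaSet_rational hq hpq hr hx⟩
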